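/- **Setting.** Let $d\ge 2$ and let $x_1,\dots,x_n\in\mathbb R^d$ be any data (in particular, any realization of an i.i.d. sample). Put $A=\frac1n\sum_i x_ix_i^\top$, with eigenvalues $s_1\ge s_2\ge\dots\ge s_d$, and let $w^*$ be a unit eigenvector of $A$ for $s_1$. The Quasi-PS algorithm with step size $\eta$ and epoch length $M$ takes a random vector $g\in\mathbb R^d$ of arbitrary law (for instance $\mathcal N(0,I_d)$, or a deterministic vector) and puts $\tilde w_0=g/\|g\|$ (read as $0$ if $g=0$). In epoch $l=1,2,\dots$ it puts $\tilde u=\frac1n\sum_i x_i(x_i^\top\tilde w_{l-1})$ and $w_0=\tilde w_{l-1}$. For $s=1,\dots,M$ it picks $i_s\in\{1,\dots,n\}$ uniformly at random and sets $$w_s'=w_{s-1}+\eta\,[x_{i_s}(x_{i_s}^\top w_{s-1}-x_{i_s}^\top\tilde w_{l-1})+\tilde u],\qquad w_s=w_s'/\|w_s'\|_2 .$$ Finally $\tilde w_l=w_M$. All picks are mutually independent, and jointly independent of $g$. Let $\mu$ be a probability law on $\mathbb R^d$ with finite second moment, $\Sigma^*=\mathbb E_{x\sim\mu}[xx^\top]$,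 and let $\lambda_{\max}(\Sigma^*)$ be the largest eigenvalue of $\Sigma^*$. **Theorem.** There are universal constants $c_1,c_2,c_3>0$ such that the following holds for all such $d$, $n$, $x_1,\dots,x_n$, $w^*$, $\mu$ and $g$. Let $r>0$ with $\max_i\|x_i\|_2^2\le r$, suppose $\lambda:=s_1-s_2>0$, let $\delta,\varepsilon\in(0,1)$, and let $\eta>0$ and $M\in\mathbb N$ satisfy $$\eta\le \frac{c_1\delta^2}{r^2}\lambda,\qquad M\ge\frac{c_2\log(2/\delta)}{\eta\lambda},\qquad M\eta^2r^2+r\sqrt{M\eta^2\log(2/\delta)}\le c_3 .$$ Let $L=\lceil\log(1/\varepsilon)/\log(2/\delta)\rceil$, and suppose that $\langle\tilde w_0,w^*\rangle\ge 1/\sqrt2$ has positive probability. Then: 1. for every outcome of the algorithm, $x\mapsto |x^\top\tilde w_L-x^\top w^*|^2$ is $\mu$-integrable and $$\mathbb E_{x\sim\mu}\,|x^\top\tilde w_L-x^\top w^*|^2=(\tilde w_L-w^*)^\top\Sigma^*(\tilde w_L-w^*)\le\lambda_{\max}(\Sigma^*)\,\|\tilde w_L-w^*\|_2^2 ;$$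 2. conditionally on $\langle\tilde w_0,w^*\rangle\ge 1/\sqrt2$, with probability at least $1-\max\{1,\log_2(1/\varepsilon)\}\,\delta$ over the randomness of the algorithm, both $$\|\tilde w_L-w^*\|_2^2\le 2-2\sqrt{1-\varepsilon}\qquad\text{and}\qquad \mathbb E_{x\sim\mu}\,|x^\top\tilde w_L-x^\top w^*|^2\le(2-2\sqrt{1-\varepsilon})\,\lambda_{\max}(\Sigma^*)$$ hold, where in the expectation $x\sim\mu$ is drawn independently of $\tilde w_L$. -/

import Mathlib

open MeasureTheory ProbabilityTheory
open scoped Matrix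

noncomputable section

namespace QuasiPS

/-- The full-batch vector `(1/n) ∑ᵢ xᵢ (xᵢᵀ w)` of the data `x₁, …, xₙ`. -/
def fullBatch {n d : ℕ} (x : Fin n → EuclideanSpace ℝ (Fin d))
    (w : EuclideanSpace ℝ (Fin d)) : EuclideanSpace ℝ (Fin d) :=
  (n : ℝ)⁻¹ • ∑ i, (inner ℝ (x i) w) • x i

/-- One variance-reduced stochastic step inside an epoch with anchor `wt`, when index `i` is
picked: `w' = w + η [xᵢ (xᵢᵀ w - xᵢᵀ wt) + ũ]`, followed by normalization. -/
def innerStep {n d : ℕ} (x : Fin n → EuclideanSpace ℝ (Fin d)) (η : ℝ)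
    (wt w : EuclideanSpace ℝ (Fin d)) (i : Fin n) : EuclideanSpace ℝ (Fin d) :=
  NormedSpace.normalize
    (w + η • ((inner ℝ (x i) w - inner ℝ (x i) wt) • x i + fullBatch x wt))

/-- The inner iterates `w₀ = wt, w₁, w₂, …` of one epoch; step `s + 1` uses the index `pick s`. -/
def epochIterate {n d : ℕ} (x : Fin n → EuclideanSpace ℝ (Fin d)) (η : ℝ)
    (wt : EuclideanSpace ℝ (Fin d)) (pick : ℕ → Fin n) : ℕ → EuclideanSpace ℝ (Fin d)
  | 0 => wt
  | s + 1 => innerStep x η wt (epochIterate x η wt pick s) (pick s)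

/-- The epoch iterates `w̃₀, w̃₁, …` with epoch length `M`, started at the normalization of `g`;
epoch `l + 1` uses the indices `pick (l, 0), …, pick (l, M - 1)`. -/
def estimate {n d : ℕ} (x : Fin n → EuclideanSpace ℝ (Fin d)) (η : ℝ) (M : ℕ)
    (g : EuclideanSpace ℝ (Fin d)) (pick : ℕ × ℕ → Fin n) : ℕ → EuclideanSpace ℝ (Fin d)
  | 0 => NormedSpace.normalize g
  | l + 1 => epochIterate x η (estimate x η M g pick l) (fun s => pick (l, s)) M

/-- The sample matrix `(1/n) ∑ᵢ xᵢ xᵢᵀ`. -/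
def sampleCov {n d : ℕ} (x : Fin n → EuclideanSpace ℝ (Fin d)) : Matrix (Fin d) (Fin d) ℝ :=
  Matrix.of fun j k => (n : ℝ)⁻¹ * ∑ i, x i j * x i k

/-- The population matrix `𝔼 [x xᵀ]` for `x` with law `μ`. -/
def trueCov {d : ℕ} (μ : Measure (EuclideanSpace ℝ (Fin d))) : Matrix (Fin d) (Fin d) ℝ :=
  Matrix.of fun j k => ∫ x, x j * x k ∂μ

theorem sampleCov_isHermitian {n d : ℕ} (x : Fin n → EuclideanSpace ℝ (Fin d)) :
    (sampleCov x).IsHermitian := by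
  ext j k
  simp [sampleCov, mul_comm]

theorem trueCov_isHermitian {d : ℕ} (μ : Measure (EuclideanSpace ℝ (Fin d))) :
    (trueCov μ).IsHermitian := by
  ext j k
  simp [trueCov, mul_comm]

/-- The eigenvalues of a real symmetric matrix, with multiplicity, in decreasing order. -/
def sortedEigenvalues {d : ℕ} {A : Matrix (Fin d) (Fin d) ℝ} (hA : A.IsHermitian) :
    Fin d → ℝ :=
  fun k => hA.eigenvalues₀ (Fin.cast (Fintype.card_fin d).symm k)

/-- The largest eigenvalue of a real symmetric matrix. -/
def lambdaMax {d : ℕ} (hd : 2 ≤ d) {A : Matrix (Fin d) (Fin d) ℝ} (hA : A.IsHermitian) : ℝ :=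
  sortedEigenvalues hA ⟨0, by omega⟩

/-- The gap between the first and the second eigenvalue of a real symmetric matrix. -/
def eigengap {d : ℕ} (hd : 2 ≤ d) {A : Matrix (Fin d) (Fin d) ℝ} (hA : A.IsHermitian) : ℝ :=
  sortedEigenvalues hA ⟨0, by omega⟩ - sortedEigenvalues hA ⟨1, by omega⟩

end QuasiPS

end

/-! Write v for w*, λ for the eigengap and b(w) = 1 - ⟨w, v⟩² (`sinSq`). An inner step normalizes
the exact power step w + ηAw plus a noise vector that averages to zero over the pick and has norm at
most 2ηr‖w - w̃‖, where w̃ is the anchor. While ⟨w, v⟩ ≥ 1/2, the power step multiplies b by at most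
1 - ηλ/8. In a second-order expansion of b the linear noise term averages out, and the quadratic one
is O(η²r²(b(w) + b(w̃))), because ‖w - w̃‖² ≤ 4(b(w) + b(w̃)) on this side of v. Hence b contracts
in mean by 1 - ηλ/16, up to an error 800η²r²b(w̃) (`average_sinSq_innerStep_le`). The error is
proportional to that of the anchor, so a fixed step size gains a constant factor in every epoch.

The contraction is unavailable once ⟨w, v⟩ < 1/2, so exits have to be rare. At an exit b > 3/4,
hence exp(θ(b - 3/4)) ≥ 1, and this quantity grows in mean only by a factor 1 + O((θ + θ²)η²r²) per
step. `stepAverage_missIndicator_le` adds it to the Markov bound for b; the sum dominates the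
conditional failure probability, by induction on the number of remaining steps, with no stopping
time. For θ = 16 log(2/δ) each summand is at most δ/4, so an epoch shrinks the bound on b by δ/2
except with probability δ/2 (`stepAverage_missIndicator_le_half`).

A union bound over the L epochs starts from b ≤ 1/2, for a frozen initial vector; Fubini restores
the random one. Finally ‖w - v‖² = 2 - 2⟨w, v⟩ turns the angle into a distance, and the prediction
error is the quadratic form of Σ* at w - v. -/

noncomputable section

namespace QuasiPS

/-! ### Angles of normalized vectors -/

section Geometry

variable {E : Type*} [NormedAddCommGroup E] [InnerProductSpace ℝ E]

/-- The squared sine of the angle between the unit vectors `v` and `w`. -/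
def sinSq (v w : E) : ℝ := 1 - inner ℝ w v ^ 2

theorem sinSq_normalize (v y : E) (hy : y ≠ 0) :
    sinSq v (NormedSpace.normalize y) = (‖y‖ ^ 2 - inner ℝ y v ^ 2) / ‖y‖ ^ 2 := by
  have h : ‖y‖ ≠ 0 := norm_ne_zero_iff.mpr hy
  rw [sinSq, NormedSpace.normalize, real_inner_smul_left]
  field_simp

theorem inner_sq_le_norm_sq {v : E} (hv : ‖v‖ = 1) (y : E) : inner ℝ y v ^ 2 ≤ ‖y‖ ^ 2 := by
  have h := abs_real_inner_le_norm y v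
  rw [hv, mul_one] at h
  exact sq_le_sq' (by linarith [neg_abs_le (inner ℝ y v : ℝ)]) ((le_abs_self _).trans h)

theorem sinSq_nonneg {v w : E} (hv : ‖v‖ = 1) (hw : ‖w‖ = 1) : 0 ≤ sinSq v w := by
  have := inner_sq_le_norm_sq hv w
  rw [hw] at this
  unfold sinSq; linarith

/-- Second-order upper bound for the ratio `(N - (a + b)²) / N` when `N = u² + 2 A + m²`. -/
theorem ratio_perturbation_le {u m A a b N : ℝ} (hm0 : 0 ≤ m) (hm : m ≤ 1 / 2) (hu : 1 ≤ u)
    (hqv : a ^ 2 ≤ u ^ 2) (hev : b ^ 2 ≤ m ^ 2) (hev' : |b| ≤ m) (hqv' : |a| ≤ u)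
    (hqe' : |A| ≤ u * m) (hN : N = u ^ 2 + 2 * A + m ^ 2) (hNq : u ^ 2 / 4 ≤ N) :
    (N - (a + b) ^ 2) / N ≤ (u ^ 2 - a ^ 2) / u ^ 2 +
      2 / u ^ 2 * ((1 - (u ^ 2 - a ^ 2) / u ^ 2) * A - a * b) + 50 * m ^ 2 := by
  set β := (u ^ 2 - a ^ 2) / u ^ 2 with hβ
  have hu2 : 1 ≤ u ^ 2 := by nlinarith
  have hβ0 : 0 ≤ β := div_nonneg (by linarith) (by positivity)
  have hβ1 : β ≤ 1 := by
    rw [hβ, div_le_one (by positivity)]; nlinarith [sq_nonneg a]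
  have hβu : β * u ^ 2 = u ^ 2 - a ^ 2 := by rw [hβ]; field_simp
  have hN0 : 0 < N := by linarith
  set ℓ := (1 - β) * A - a * b with hℓ
  set D := 2 * ℓ + (m ^ 2 - b ^ 2 - β * m ^ 2) with hD
  -- This identity is exact, so the ratio is β + D / N. The only approximation left is D / u² for D
  -- / N, an error of second order because D and N - u² are both O(um).
  have hDN : N - (a + b) ^ 2 = β * N + D := by rw [hD, hℓ, hN]; linear_combination (-1) * hβu
  have hm1 : |m ^ 2 - b ^ 2 - β * m ^ 2| ≤ m ^ 2 := by
    rw [abs_le]; constructor <;> nlinarith [sq_nonneg b, mul_le_mul_of_nonneg_right hβ1 (sq_nonneg m), mul_nonneg hβ0 (sq_nonneg m)]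
  have hmu : m ^ 2 ≤ u * m / 2 := by nlinarith
  have hℓ1 : |ℓ| ≤ 2 * (u * m) := by
    have h1 : |(1 - β) * A| ≤ u * m := by
      rw [abs_mul, abs_of_nonneg (by linarith : 0 ≤ 1 - β)]
      nlinarith [abs_nonneg A]
    have h2 : |a * b| ≤ u * m := by
      rw [abs_mul]; exact mul_le_mul hqv' hev' (abs_nonneg _) (by positivity)
    have := abs_sub ((1 - β) * A) (a * b)
    linarith
  have hD1 : |D| ≤ 9 / 2 * (u * m) := by
    have := abs_add_le (2 * ℓ) (m ^ 2 - b ^ 2 - β * m ^ 2)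
    rw [abs_mul, abs_two] at this
    linarith
  have hy1 : |u ^ 2 - N| ≤ 5 / 2 * (u * m) := by
    rw [hN, show u ^ 2 - (u ^ 2 + 2 * A + m ^ 2) = -(2 * A + m ^ 2) by ring, abs_neg]
    have := abs_add_le (2 * A) (m ^ 2)
    rw [abs_mul, abs_two, abs_of_nonneg (sq_nonneg m)] at this
    linarith
  have key : D / N - D / u ^ 2 ≤ 45 * m ^ 2 := by
    rw [div_sub_div _ _ hN0.ne' (by positivity), div_le_iff₀ (by positivity)]
    have h1 : D * u ^ 2 - N * D ≤ 9 / 2 * (u * m) * (5 / 2 * (u * m)) := by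
      calc D * u ^ 2 - N * D = D * (u ^ 2 - N) := by ring
        _ ≤ |D| * |u ^ 2 - N| := by rw [← abs_mul]; exact le_abs_self _
        _ ≤ _ := mul_le_mul hD1 hy1 (abs_nonneg _) (by positivity)
    have h2 : u ^ 2 / 4 * (m ^ 2 * u ^ 2) ≤ N * (m ^ 2 * u ^ 2) :=
      mul_le_mul_of_nonneg_right hNq (by positivity)
    have h3 : m ^ 2 * u ^ 2 ≤ m ^ 2 * u ^ 2 * u ^ 2 := le_mul_of_one_le_right (by positivity) hu2
    nlinarith
  have hD2 : D / u ^ 2 ≤ 2 / u ^ 2 * ℓ + m ^ 2 := by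
    have : (m ^ 2 - b ^ 2 - β * m ^ 2) / u ^ 2 ≤ m ^ 2 :=
      (div_le_iff₀ (by positivity)).mpr
        ((le_abs_self _).trans (hm1.trans (le_mul_of_one_le_right (by positivity) hu2)))
    rw [hD, add_div]
    have e1 : 2 * ℓ / u ^ 2 = 2 / u ^ 2 * ℓ := by ring
    linarith
  have e2 : (N - (a + b) ^ 2) / N = β + D / N := by rw [hDN]; field_simp
  rw [e2]
  nlinarith [sq_nonneg m]

/-- Second-order upper bound for the squared sine of the angle of a perturbed vector. -/
theorem sinSq_normalize_add_le {v q e : E} (hv : ‖v‖ = 1) (hq : 1 ≤ ‖q‖) (he : ‖e‖ ≤ 1 / 2) :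
    sinSq v (NormedSpace.normalize (q + e)) ≤ (‖q‖ ^ 2 - inner ℝ q v ^ 2) / ‖q‖ ^ 2 +
      inner ℝ e ((2 / ‖q‖ ^ 2) • ((1 - (‖q‖ ^ 2 - inner ℝ q v ^ 2) / ‖q‖ ^ 2) • q
        - (inner ℝ q v : ℝ) • v)) + 50 * ‖e‖ ^ 2 := by
  have hqe : ‖q‖ / 2 ≤ ‖q + e‖ := by
    have := norm_sub_norm_le q (-e)
    rw [sub_neg_eq_add, norm_neg] at this
    linarith
  have hne : q + e ≠ 0 := norm_pos_iff.mp (by linarith)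
  rw [sinSq_normalize v _ hne]
  have hqv := inner_sq_le_norm_sq hv q
  have hev := inner_sq_le_norm_sq hv e
  have hev' : |(inner ℝ e v : ℝ)| ≤ ‖e‖ := by
    simpa [hv] using abs_real_inner_le_norm e v
  have hqv' : |(inner ℝ q v : ℝ)| ≤ ‖q‖ := by
    simpa [hv] using abs_real_inner_le_norm q v
  have hqe' : |(inner ℝ q e : ℝ)| ≤ ‖q‖ * ‖e‖ := abs_real_inner_le_norm q e
  have hN : ‖q + e‖ ^ 2 = ‖q‖ ^ 2 + 2 * inner ℝ q e + ‖e‖ ^ 2 := norm_add_sq_real q e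
  have hNq : ‖q‖ ^ 2 / 4 ≤ ‖q + e‖ ^ 2 := by nlinarith
  rw [inner_smul_right, inner_sub_right, inner_smul_right, inner_smul_right, inner_add_left,
    real_inner_comm q e]
  exact ratio_perturbation_le (norm_nonneg e) he hq hqv hev hev' hqv' hqe' hN hNq

/-- With c = ⟨w, v⟩ in [0, 1] one has c² ≤ c, so 2 - 2c ≤ 2(1 - c²). This is what makes the noise
small when the angles are small. -/
theorem norm_sub_sq_le_sinSq {v w : E} (hv : ‖v‖ = 1) (hw : ‖w‖ = 1) (h : 0 ≤ (inner ℝ w v : ℝ)) :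
    ‖w - v‖ ^ 2 ≤ 2 * sinSq v w := by
  have h1 : (inner ℝ w v : ℝ) ≤ 1 := by simpa [hv, hw] using real_inner_le_norm w v
  rw [norm_sub_sq_real, hv, hw, sinSq]
  nlinarith

theorem abs_sinSq_sub_sinSq_le {v w w' : E} (hv : ‖v‖ = 1) (hw : ‖w‖ = 1) (hw' : ‖w'‖ = 1) :
    |sinSq v w' - sinSq v w| ≤ 2 * ‖w' - w‖ := by
  have h1 : |(inner ℝ w v : ℝ)| ≤ 1 := by simpa [hv, hw] using abs_real_inner_le_norm w v
  have h2 : |(inner ℝ w' v : ℝ)| ≤ 1 := by simpa [hv, hw'] using abs_real_inner_le_norm w' v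
  have h3 : |(inner ℝ (w' - w) v : ℝ)| ≤ ‖w' - w‖ := by
    simpa [hv] using abs_real_inner_le_norm (w' - w) v
  rw [inner_sub_left] at h3
  have h4 : sinSq v w' - sinSq v w =
      -((inner ℝ w' v - inner ℝ w v) * (inner ℝ w' v + inner ℝ w v)) := by
    unfold sinSq; ring
  rw [h4, abs_neg, abs_mul, mul_comm 2]
  refine mul_le_mul h3 ?_ (abs_nonneg _) (norm_nonneg _)
  linarith [abs_add_le (inner ℝ w' v : ℝ) (inner ℝ w v)]

theorem norm_normalize_add_sub_le {w u : E} (hw : ‖w‖ = 1) (h : w + u ≠ 0) :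
    ‖NormedSpace.normalize (w + u) - w‖ ≤ 2 * ‖u‖ := by
  have h1 : ‖NormedSpace.normalize (w + u) - (w + u)‖ ≤ ‖u‖ := by
    have hn : ‖w + u‖ ≠ 0 := norm_ne_zero_iff.mpr h
    have : NormedSpace.normalize (w + u) - (w + u) =
        (1 - ‖w + u‖) • NormedSpace.normalize (w + u) := by
      rw [sub_smul, one_smul, NormedSpace.norm_smul_normalize]
    rw [this, norm_smul, NormedSpace.norm_normalize_eq_one_iff.mpr h, mul_one, Real.norm_eq_abs]
    have := abs_norm_sub_norm_le w (w + u)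
    rwa [hw, sub_add_cancel_left, norm_neg] at this
  calc _ = ‖(NormedSpace.normalize (w + u) - (w + u)) + u‖ := by congr 1; abel
    _ ≤ _ := by linarith [norm_add_le (NormedSpace.normalize (w + u) - (w + u)) u]

/-- One exact power step with gap contracts the squared sine. -/
theorem div_le_of_gap {a m k Q : ℝ} (ha : 1 / 2 ≤ a) (ha1 : a ≤ 1) (hm : 1 ≤ m) (hmk : m ≤ k)
    (hk : k ≤ 2) (hQ0 : 0 ≤ Q) (hQ : Q ≤ m ^ 2 * (1 - a ^ 2)) :
    Q / ((k * a) ^ 2 + Q) ≤ (1 - (k - m) / 8) * (1 - a ^ 2) := by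
  have hka : 0 < (k * a) ^ 2 := by have : 0 < k * a := by nlinarith
                                   positivity
  rw [div_le_iff₀ (by positivity)]
  set b := 1 - a ^ 2 with hb
  have ha2 : 1 / 4 ≤ a ^ 2 := by nlinarith
  have hb0 : 0 ≤ b := by nlinarith
  set t := (k - m) / 8 with ht
  have ht0 : 0 ≤ t := by rw [ht]; linarith
  have ht1 : t ≤ 1 / 8 := by rw [ht]; linarith
  have hmt : m = k - 8 * t := by rw [ht]; ring
  have hb1 : b ≤ 3 / 4 := by linarith
  have h1 : Q * (1 - (1 - t) * b) ≤ m ^ 2 * b * (1 - (1 - t) * b) := by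
    apply mul_le_mul_of_nonneg_right hQ; nlinarith
  -- The claim with Q at its largest value and b cancelled. The 8 in t pays for 1 - b ≥ 1/4 and k ≤
  -- 2.
  have h2 : m ^ 2 * (1 - (1 - t) * b) ≤ (1 - t) * k ^ 2 * (1 - b) := by
    have h3 : m ^ 2 ≤ k ^ 2 - 8 * t * k := by rw [hmt]; nlinarith
    have h4 : m ^ 2 * (1 - (1 - t) * b) ≤ (k ^ 2 - 8 * t * k) * (1 - (1 - t) * b) := by
      apply mul_le_mul_of_nonneg_right h3; nlinarith
    have h5 : (k ^ 2 - 8 * t * k) * (1 - (1 - t) * b) ≤ (1 - t) * k ^ 2 * (1 - b) := by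
      have h6 : k * (k ^ 1 * 1) ≤ k * 2 := by nlinarith
      have h7 : 1 / 4 ≤ 1 - (1 - t) * b := by nlinarith
      have h8 : k * t ≤ 8 * t * (1 - (1 - t) * b) := by nlinarith
      have h9 : k * (k * t) ≤ k * (8 * t * (1 - (1 - t) * b)) :=
        mul_le_mul_of_nonneg_left h8 (by linarith)
      nlinarith
    linarith
  have h3 : m ^ 2 * b * (1 - (1 - t) * b) ≤ (1 - t) * k ^ 2 * (1 - b) * b := by
    have := mul_le_mul_of_nonneg_right h2 hb0
    linarith
  have h4 : (k * a) ^ 2 = k ^ 2 * (1 - b) := by rw [hb]; ring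
  rw [h4]; nlinarith

end Geometry

/-! ### Spectral gap and Rayleigh quotient -/

section Spectral

variable {d : ℕ} {A : Matrix (Fin d) (Fin d) ℝ}

theorem inner_toLp_mulVec (hA : A.IsHermitian) (y z : EuclideanSpace ℝ (Fin d)) :
    inner ℝ y (WithLp.toLp 2 (A *ᵥ z.ofLp)) = inner ℝ (WithLp.toLp 2 (A *ᵥ y.ofLp)) z := by
  have hT : Aᵀ = A := by
    rw [← Matrix.conjTranspose_eq_transpose_of_trivial]; exact hA.eq
  simp only [EuclideanSpace.inner_eq_star_dotProduct, star_trivial]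
  rw [Matrix.dotProduct_mulVec, ← Matrix.mulVec_transpose, hT, dotProduct_comm, dotProduct_comm,
    dotProduct_comm]

theorem inner_eigenvectorBasis_mulVec (hA : A.IsHermitian) (j : Fin d)
    (y : EuclideanSpace ℝ (Fin d)) :
    inner ℝ (hA.eigenvectorBasis j) (WithLp.toLp 2 (A *ᵥ y.ofLp)) =
      hA.eigenvalues j * inner ℝ (hA.eigenvectorBasis j) y := by
  rw [inner_toLp_mulVec hA, hA.mulVec_eigenvectorBasis, ← WithLp.ofLp_smul, WithLp.toLp_ofLp,
    real_inner_smul_left]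

/-- `eigenvalues` is the sorted family `eigenvalues₀` carried along an arbitrary bijection of
indices; undoing that bijection locates the top eigenvalue, and every other index lies at sorted
position 1 or later. -/
theorem exists_index_of_eigengap (hd : 2 ≤ d) (hA : A.IsHermitian) :
    ∃ i₀, hA.eigenvalues i₀ = lambdaMax hd hA ∧
      ∀ j ≠ i₀, hA.eigenvalues j ≤ lambdaMax hd hA - eigengap hd hA := by
  set e : Fin (Fintype.card (Fin d)) ≃ Fin d :=
    Fintype.equivOfCardEq (Fintype.card_fin (Fintype.card (Fin d)))
  refine ⟨e (Fin.cast (Fintype.card_fin d).symm ⟨0, by omega⟩), ?_, fun j hj => ?_⟩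
  · simp [Matrix.IsHermitian.eigenvalues, lambdaMax, sortedEigenvalues, e]
  · have h : (e.symm j).val ≠ 0 := by
      intro h0
      apply hj
      rw [← Equiv.symm_apply_eq]
      ext
      simpa using h0
    rw [eigengap, lambdaMax, sub_sub_cancel]
    apply hA.eigenvalues₀_antitone
    rw [Fin.le_def]
    simpa [Nat.one_le_iff_ne_zero] using h

theorem eigengap_nonneg (hd : 2 ≤ d) (hA : A.IsHermitian) : 0 ≤ eigengap hd hA := by
  rw [eigengap, sub_nonneg]
  apply hA.eigenvalues₀_antitone
  simp [Fin.le_def]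

theorem eigenvalues_le_lambdaMax (hd : 2 ≤ d) (hA : A.IsHermitian) (j : Fin d) :
    hA.eigenvalues j ≤ lambdaMax hd hA := by
  obtain ⟨i, hi, h⟩ := exists_index_of_eigengap hd hA
  rcases eq_or_ne j i with rfl | hj
  · exact hi.le
  · linarith [h j hj, eigengap_nonneg hd hA]

/-- The Rayleigh quotient is at most the largest eigenvalue. -/
theorem dotProduct_mulVec_le_lambdaMax (hd : 2 ≤ d) (hA : A.IsHermitian)
    (y : EuclideanSpace ℝ (Fin d)) :
    y.ofLp ⬝ᵥ (A *ᵥ y.ofLp) ≤ lambdaMax hd hA * ‖y‖ ^ 2 := by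
  have h : y.ofLp ⬝ᵥ (A *ᵥ y.ofLp) = inner ℝ y (WithLp.toLp 2 (A *ᵥ y.ofLp)) := by
    rw [EuclideanSpace.inner_eq_star_dotProduct, star_trivial, dotProduct_comm]
  rw [h, ← hA.eigenvectorBasis.sum_inner_mul_inner, ← real_inner_self_eq_norm_sq,
    ← hA.eigenvectorBasis.sum_inner_mul_inner, Finset.mul_sum]
  refine Finset.sum_le_sum fun j _ => ?_
  rw [inner_eigenvectorBasis_mulVec, real_inner_comm]
  nlinarith [eigenvalues_le_lambdaMax hd hA j,
    sq_nonneg (inner ℝ (hA.eigenvectorBasis j) y : ℝ)]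

/-- On the orthogonal complement of a top eigenvector, a positive semidefinite matrix has norm
at most its second eigenvalue. -/
theorem norm_mulVec_le_of_inner_eq_zero (hd : 2 ≤ d) (hA : A.IsHermitian)
    (hpos : ∀ z : EuclideanSpace ℝ (Fin d), 0 ≤ inner ℝ z (WithLp.toLp 2 (A *ᵥ z.ofLp)))
    (hgap : 0 < eigengap hd hA) {v : EuclideanSpace ℝ (Fin d)} (hv : v ≠ 0)
    (hAv : A *ᵥ v.ofLp = lambdaMax hd hA • v.ofLp) :
    0 ≤ lambdaMax hd hA - eigengap hd hA ∧
    ∀ y : EuclideanSpace ℝ (Fin d), inner ℝ y v = 0 →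
      ‖WithLp.toLp 2 (A *ᵥ y.ofLp)‖ ≤ (lambdaMax hd hA - eigengap hd hA) * ‖y‖ := by
  obtain ⟨i, hi, h⟩ := exists_index_of_eigengap hd hA
  set u := hA.eigenvectorBasis
  have hnn : ∀ j, 0 ≤ hA.eigenvalues j := fun j => by
    have := hpos (u j)
    rwa [inner_eigenvectorBasis_mulVec, real_inner_self_eq_norm_sq, u.norm_eq_one, one_pow,
      mul_one] at this
  have ht : 0 ≤ lambdaMax hd hA - eigengap hd hA := by
    have : Nontrivial (Fin d) := Fin.nontrivial_iff_two_le.mpr hd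
    obtain ⟨j, hj⟩ := exists_ne i
    exact (hnn j).trans (h j hj)
  refine ⟨ht, fun y hy => ?_⟩
  -- By the strict gap the top eigenspace is a line, so v is a multiple of u i, and orthogonality to
  -- v removes exactly the i-th coordinate of y.
  have hvj : ∀ j ≠ i, inner ℝ (u j) v = 0 := fun j hj => by
    have h1 := inner_eigenvectorBasis_mulVec hA j v
    rw [hAv, ← WithLp.ofLp_smul, WithLp.toLp_ofLp, real_inner_smul_right] at h1
    have h2 : (lambdaMax hd hA - hA.eigenvalues j) * inner ℝ (u j) v = 0 := by
      rw [sub_mul, h1, sub_self]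
    exact (mul_eq_zero.mp h2).resolve_left (by linarith [h j hj])
  have hsum : ∀ z : EuclideanSpace ℝ (Fin d),
      inner ℝ z v = inner ℝ z (u i) * inner ℝ (u i) v := fun z => by
    rw [← u.sum_inner_mul_inner]
    exact Finset.sum_eq_single i (fun j _ hj => by rw [hvj j hj, mul_zero]) (by simp)
  have hyi : inner ℝ (u i) y = 0 := by
    have h1 := hsum y
    rw [hy] at h1
    rcases mul_eq_zero.mp h1.symm with h2 | h2
    · rwa [real_inner_comm]
    · exact absurd (inner_self_eq_zero.mp ((hsum v).trans (by rw [h2, mul_zero]))) hv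
  apply le_of_sq_le_sq _ (by positivity)
  rw [mul_pow, ← real_inner_self_eq_norm_sq, ← real_inner_self_eq_norm_sq y,
    ← u.sum_inner_mul_inner, ← u.sum_inner_mul_inner y, Finset.mul_sum]
  refine Finset.sum_le_sum fun j _ => ?_
  rw [real_inner_comm, real_inner_comm (u j) y, inner_eigenvectorBasis_mulVec]
  rcases eq_or_ne j i with rfl | hj
  · rw [hyi]; simp
  · have := mul_self_le_mul_self (hnn j) (h j hj)
    nlinarith [mul_self_nonneg (inner ℝ (u j) y : ℝ)]

end Spectral

/-! ### The sample matrix as an operator -/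

section FullBatch

variable {n d : ℕ} (x : Fin n → EuclideanSpace ℝ (Fin d))

theorem toLp_sampleCov_mulVec (y : EuclideanSpace ℝ (Fin d)) :
    WithLp.toLp 2 (sampleCov x *ᵥ y.ofLp) = fullBatch x y := by
  ext j
  simp only [sampleCov, fullBatch, Matrix.mulVec, dotProduct, Matrix.of_apply, PiLp.smul_apply,
    WithLp.ofLp_sum, Finset.sum_apply, WithLp.ofLp_smul, Pi.smul_apply, smul_eq_mul, PiLp.inner_apply,
    RCLike.inner_apply, conj_trivial]
  simp only [Finset.mul_sum, Finset.sum_mul]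
  rw [Finset.sum_comm]
  exact Finset.sum_congr rfl fun i _ => Finset.sum_congr rfl fun k _ => by ring

theorem inner_fullBatch (y z : EuclideanSpace ℝ (Fin d)) :
    inner ℝ y (fullBatch x z) = (n : ℝ)⁻¹ * ∑ i, inner ℝ (x i) z * inner ℝ (x i) y := by
  rw [fullBatch, real_inner_smul_right, inner_sum]
  congr 1
  exact Finset.sum_congr rfl fun i _ => by rw [real_inner_smul_right, real_inner_comm y]

theorem inner_fullBatch_self_nonneg (y : EuclideanSpace ℝ (Fin d)) :
    0 ≤ inner ℝ y (fullBatch x y) := by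
  rw [inner_fullBatch]
  exact mul_nonneg (by positivity) (Finset.sum_nonneg fun i _ => mul_self_nonneg _)

theorem fullBatch_add (y z : EuclideanSpace ℝ (Fin d)) :
    fullBatch x (y + z) = fullBatch x y + fullBatch x z := by
  simp [fullBatch, inner_add_right, add_smul, Finset.sum_add_distrib]

theorem fullBatch_smul (c : ℝ) (y : EuclideanSpace ℝ (Fin d)) :
    fullBatch x (c • y) = c • fullBatch x y := by
  simp only [fullBatch, inner_smul_right, mul_smul]
  rw [← Finset.smul_sum, smul_comm]

theorem fullBatch_sub (y z : EuclideanSpace ℝ (Fin d)) :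
    fullBatch x (y - z) = fullBatch x y - fullBatch x z := by
  simp [fullBatch, inner_sub_right, sub_smul, Finset.sum_sub_distrib, smul_sub]

variable {x}

theorem norm_inner_smul_le {r : ℝ} (hx : ∀ i, ‖x i‖ ^ 2 ≤ r) (y : EuclideanSpace ℝ (Fin d))
    (i : Fin n) : ‖(inner ℝ (x i) y : ℝ) • x i‖ ≤ r * ‖y‖ := by
  rw [norm_smul]
  calc ‖(inner ℝ (x i) y : ℝ)‖ * ‖x i‖ ≤ (‖x i‖ * ‖y‖) * ‖x i‖ := by
        gcongr; exact norm_inner_le_norm _ _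
    _ = ‖x i‖ ^ 2 * ‖y‖ := by ring
    _ ≤ _ := by gcongr; exact hx i

theorem norm_fullBatch_le {r : ℝ} (hr : 0 ≤ r) (hx : ∀ i, ‖x i‖ ^ 2 ≤ r)
    (y : EuclideanSpace ℝ (Fin d)) : ‖fullBatch x y‖ ≤ r * ‖y‖ := by
  rw [fullBatch, norm_smul, Real.norm_of_nonneg (by positivity)]
  have h : ‖∑ i, (inner ℝ (x i) y : ℝ) • x i‖ ≤ n * (r * ‖y‖) := by
    simpa using norm_sum_le_of_le Finset.univ fun i _ => norm_inner_smul_le hx y i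
  rcases Nat.eq_zero_or_pos n with rfl | hn
  · simp; positivity
  · rw [inv_mul_le_iff₀ (by positivity)]; exact h

end FullBatch

/-! ### Mean contraction in one inner step -/

section OneStep

variable {n d : ℕ} {x : Fin n → EuclideanSpace ℝ (Fin d)} {η r s t : ℝ}
  {v wt w : EuclideanSpace ℝ (Fin d)}

theorem inner_fullBatch_eigenvector (hAv : fullBatch x v = s • v) (y : EuclideanSpace ℝ (Fin d)) :
    inner ℝ (fullBatch x y) v = s * inner ℝ y v := by
  rw [← real_inner_smul_right, ← hAv, real_inner_comm, inner_fullBatch, inner_fullBatch]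
  congr 1
  exact Finset.sum_congr rfl fun i _ => mul_comm _ _

/-- Positive semidefiniteness gives ⟨w, w + ηAw⟩ ≥ 1. It supplies the hypothesis `1 ≤ ‖q‖` of the
perturbation bound. -/
theorem one_le_norm_add_fullBatch (hη : 0 ≤ η) (hw : ‖w‖ = 1) : 1 ≤ ‖w + η • fullBatch x w‖ := by
  have h : (1 : ℝ) ≤ inner ℝ w (w + η • fullBatch x w) := by
    rw [inner_add_right, real_inner_smul_right, real_inner_self_eq_norm_sq, hw]
    nlinarith [mul_nonneg hη (inner_fullBatch_self_nonneg x w)]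
  exact h.trans (by simpa [hw] using real_inner_le_norm w (w + η • fullBatch x w))

/-- One exact power step contracts the squared sine of the angle to the top eigenvector. -/
theorem sinSq_power_step_le (hv : ‖v‖ = 1) (hw : ‖w‖ = 1) (hAv : fullBatch x v = s • v)
    (ht : 0 ≤ t) (hts : t ≤ s) (hperp : ∀ y, inner ℝ y v = 0 → ‖fullBatch x y‖ ≤ t * ‖y‖)
    (hη : 0 ≤ η) (hηs : η * s ≤ 1) (hwv : 1 / 2 ≤ (inner ℝ w v : ℝ)) :
    (‖w + η • fullBatch x w‖ ^ 2 - inner ℝ (w + η • fullBatch x w) v ^ 2) /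
      ‖w + η • fullBatch x w‖ ^ 2 ≤ (1 - η * (s - t) / 8) * sinSq v w := by
  set a : ℝ := inner ℝ w v with ha
  have hvv : (inner ℝ v v : ℝ) = 1 := by rw [real_inner_self_eq_norm_sq, hv, one_pow]
  set y := w - a • v with hy
  have hyv : inner ℝ y v = 0 := by
    rw [hy, inner_sub_left, real_inner_smul_left, hvv, ← ha]; ring
  have hw' : w = a • v + y := by rw [hy]; abel
  have hyn : ‖y‖ ^ 2 = 1 - a ^ 2 := by
    have : ‖w‖ ^ 2 = a ^ 2 + ‖y‖ ^ 2 := by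
      conv_lhs => rw [hw']
      rw [norm_add_sq_real, real_inner_smul_left, real_inner_comm, hyv, norm_smul, hv]
      simp
    rw [hw] at this; linarith
  set z := y + η • fullBatch x y with hz
  have hzv : inner ℝ z v = 0 := by
    rw [hz, inner_add_left, real_inner_smul_left, inner_fullBatch_eigenvector hAv, hyv]; simp
  -- The component along v grows by exactly 1 + ηs and the orthogonal one by at most 1 + ηt, which
  -- reduces the claim to the scalar `div_le_of_gap`.
  have hq : w + η • fullBatch x w = ((1 + η * s) * a) • v + z := by
    rw [hz]
    conv_lhs => rw [hw', fullBatch_add, fullBatch_smul, hAv]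
    module
  have hzn : ‖z‖ ^ 2 ≤ (1 + η * t) ^ 2 * (1 - a ^ 2) := by
    rw [← hyn, ← mul_pow]
    gcongr
    calc ‖z‖ ≤ ‖y‖ + ‖η • fullBatch x y‖ := norm_add_le _ _
      _ ≤ ‖y‖ + η * (t * ‖y‖) := by
        rw [norm_smul, Real.norm_of_nonneg hη]; gcongr; exact hperp y hyv
      _ = _ := by ring
  have hqv : inner ℝ (w + η • fullBatch x w) v = (1 + η * s) * a := by
    rw [hq, inner_add_left, real_inner_smul_left, hvv, hzv]; ring
  have hqn : ‖w + η • fullBatch x w‖ ^ 2 = ((1 + η * s) * a) ^ 2 + ‖z‖ ^ 2 := by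
    rw [hq, norm_add_sq_real, real_inner_smul_left, real_inner_comm, hzv, norm_smul, hv]
    simp [mul_pow]
  have ha1 : a ≤ 1 := by simpa [hv, hw] using real_inner_le_norm w v
  have key := div_le_of_gap (k := 1 + η * s) (m := 1 + η * t) hwv ha1 (by nlinarith)
    (by nlinarith) (by linarith) (sq_nonneg ‖z‖) hzn
  rw [hqv, hqn, add_sub_cancel_left]
  refine key.trans (le_of_eq ?_)
  rw [sinSq]; ring

/-- The centred stochastic perturbation of one inner step. -/
def stepNoise (x : Fin n → EuclideanSpace ℝ (Fin d)) (η : ℝ) (wt w : EuclideanSpace ℝ (Fin d))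
    (i : Fin n) : EuclideanSpace ℝ (Fin d) :=
  η • ((inner ℝ (x i) (w - wt) : ℝ) • x i - fullBatch x (w - wt))

/-- The anchor's full gradient cancels the mean of the stochastic correction: what remains is the
full power step at w and a noise depending only on w - wt. -/
theorem innerStep_eq_normalize_add_stepNoise (i : Fin n) :
    innerStep x η wt w i =
      NormedSpace.normalize ((w + η • fullBatch x w) + stepNoise x η wt w i) := by
  rw [innerStep, stepNoise, fullBatch_sub, inner_sub_right]
  congr 1
  module

theorem sum_stepNoise (hn : n ≠ 0) : ∑ i, stepNoise x η wt w i = 0 := by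
  simp only [stepNoise]
  rw [← Finset.smul_sum, Finset.sum_sub_distrib, Finset.sum_const, Finset.card_univ,
    Fintype.card_fin, fullBatch, ← Nat.cast_smul_eq_nsmul ℝ, smul_smul,
    mul_inv_cancel₀ (Nat.cast_ne_zero.mpr hn), one_smul, sub_self, smul_zero]

theorem norm_stepNoise_le (hη : 0 ≤ η) (hr : 0 ≤ r) (hx : ∀ i, ‖x i‖ ^ 2 ≤ r) (i : Fin n) :
    ‖stepNoise x η wt w i‖ ≤ 2 * (η * r) * ‖w - wt‖ := by
  rw [stepNoise, norm_smul, Real.norm_of_nonneg hη]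
  calc _ ≤ η * (r * ‖w - wt‖ + r * ‖w - wt‖) := by
        gcongr
        exact (norm_sub_le _ _).trans
          (add_le_add (norm_inner_smul_le hx _ i) (norm_fullBatch_le hr hx _))
    _ = _ := by ring

/-- In expectation over the pick, one inner step contracts the squared sine up to a variance term
proportional to the squared sine of the anchor. -/
theorem average_sinSq_innerStep_le (hn : n ≠ 0) (hr : 0 ≤ r) (hx : ∀ i, ‖x i‖ ^ 2 ≤ r)
    (hv : ‖v‖ = 1) (hw : ‖w‖ = 1) (hwt : ‖wt‖ = 1) (hAv : fullBatch x v = s • v)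
    (ht : 0 ≤ t) (hts : t ≤ s) (hperp : ∀ y, inner ℝ y v = 0 → ‖fullBatch x y‖ ≤ t * ‖y‖)
    (hη : 0 ≤ η) (hηr : η * r ≤ 1 / 8) (hgap : 12800 * (η * r ^ 2) ≤ s - t)
    (hwv : 1 / 2 ≤ (inner ℝ w v : ℝ)) (hwtv : 0 ≤ (inner ℝ wt v : ℝ)) :
    (n : ℝ)⁻¹ * ∑ i, sinSq v (innerStep x η wt w i) ≤
      (1 - η * (s - t) / 16) * sinSq v w + 800 * (η ^ 2 * r ^ 2) * sinSq v wt := by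
  have hsr : s ≤ r := by
    have := norm_fullBatch_le hr hx v
    rw [hAv, norm_smul, hv, mul_one, mul_one] at this
    exact (le_abs_self s).trans this
  have hηs : η * s ≤ 1 := by nlinarith
  set q := w + η • fullBatch x w with hq
  have hq1 : 1 ≤ ‖q‖ := one_le_norm_add_fullBatch hη hw
  have hdiff : ‖w - wt‖ ^ 2 ≤ 4 * (sinSq v w + sinSq v wt) := by
    have h1 := norm_sub_sq_le_sinSq hv hw (by linarith)
    have h2 := norm_sub_sq_le_sinSq hv hwt hwtv
    have h3 : ‖w - wt‖ ≤ ‖w - v‖ + ‖wt - v‖ := by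
      rw [norm_sub_rev wt v]; exact norm_sub_le_norm_sub_add_norm_sub _ _ _
    nlinarith [norm_nonneg (w - wt), sq_nonneg (‖w - v‖ - ‖wt - v‖)]
  have hdiff2 : ‖w - wt‖ ≤ 2 := by
    have := norm_sub_le w wt
    rw [hw, hwt] at this; linarith
  have hηr0 : 0 ≤ η * r := mul_nonneg hη hr
  have hpert : ∀ i, sinSq v (innerStep x η wt w i) ≤ (1 - η * (s - t) / 8) * sinSq v w +
      inner ℝ (stepNoise x η wt w i) ((2 / ‖q‖ ^ 2) • ((1 - (‖q‖ ^ 2 - inner ℝ q v ^ 2) /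
        ‖q‖ ^ 2) • q - (inner ℝ q v : ℝ) • v)) +
      800 * (η ^ 2 * r ^ 2) * (sinSq v w + sinSq v wt) := fun i => by
    have he := norm_stepNoise_le (wt := wt) (w := w) hη hr hx i
    have he2 : ‖stepNoise x η wt w i‖ ^ 2 ≤ 16 * (η ^ 2 * r ^ 2) * (sinSq v w + sinSq v wt) := by
      calc _ ≤ (2 * (η * r) * ‖w - wt‖) ^ 2 := by gcongr
        _ = 4 * (η ^ 2 * r ^ 2) * ‖w - wt‖ ^ 2 := by ring
        _ ≤ 4 * (η ^ 2 * r ^ 2) * (4 * (sinSq v w + sinSq v wt)) := by gcongr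
        _ = _ := by ring
    have h1 := sinSq_normalize_add_le (q := q) (e := stepNoise x η wt w i) hv hq1 (by nlinarith)
    have h2 := sinSq_power_step_le hv hw hAv ht hts hperp hη hηs hwv
    rw [← hq] at h2
    rw [innerStep_eq_normalize_add_stepNoise, ← hq]
    linarith
  have hsum := Finset.sum_le_sum fun i (_ : i ∈ Finset.univ) => hpert i
  rw [Finset.sum_add_distrib, Finset.sum_add_distrib, ← sum_inner, sum_stepNoise hn,
    inner_zero_left] at hsum
  simp only [Finset.sum_const, Finset.card_univ, Fintype.card_fin, nsmul_eq_mul, add_zero] at hsum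
  have hn' : (0 : ℝ) < n := by exact_mod_cast Nat.pos_of_ne_zero hn
  rw [inv_mul_le_iff₀ hn']
  refine hsum.trans ?_
  rw [← mul_add]
  apply mul_le_mul_of_nonneg_left _ hn'.le
  have hb := sinSq_nonneg hv hw
  -- Half of the contraction ηλ/8 absorbs the noise proportional to `sinSq v w`; only the anchor's
  -- share survives.
  have h3 : 800 * (η ^ 2 * r ^ 2) ≤ η * (s - t) / 16 := by nlinarith
  nlinarith

theorem norm_step_direction_le (hr : 0 ≤ r) (hx : ∀ i, ‖x i‖ ^ 2 ≤ r)
    (hw : ‖w‖ = 1) (hwt : ‖wt‖ = 1) (i : Fin n) :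
    ‖(inner ℝ (x i) w - inner ℝ (x i) wt : ℝ) • x i + fullBatch x wt‖ ≤ 3 * r := by
  rw [← inner_sub_right]
  have h1 := norm_inner_smul_le hx (w - wt) i
  have h2 := norm_fullBatch_le hr hx wt
  have h3 := norm_sub_le w wt
  have h4 := norm_add_le ((inner ℝ (x i) (w - wt) : ℝ) • x i) (fullBatch x wt)
  rw [hw, hwt] at h3
  rw [hwt] at h2
  nlinarith

/-- The increment has norm at most 3ηr ≤ 3/8 < 1, so it cannot cancel a unit vector. -/
theorem step_ne_zero (hr : 0 ≤ r) (hx : ∀ i, ‖x i‖ ^ 2 ≤ r) (hw : ‖w‖ = 1) (hwt : ‖wt‖ = 1)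
    (hη : 0 ≤ η) (hηr : η * r ≤ 1 / 8) (i : Fin n) :
    w + η • ((inner ℝ (x i) w - inner ℝ (x i) wt : ℝ) • x i + fullBatch x wt) ≠ 0 := by
  intro h
  have h1 : ‖w‖ = ‖η • ((inner ℝ (x i) w - inner ℝ (x i) wt : ℝ) • x i + fullBatch x wt)‖ := by
    simpa only [norm_neg] using congrArg norm (eq_neg_of_add_eq_zero_left h)
  rw [hw, norm_smul, Real.norm_of_nonneg hη] at h1
  nlinarith [norm_step_direction_le hr hx hw hwt i]

theorem norm_innerStep (hr : 0 ≤ r) (hx : ∀ i, ‖x i‖ ^ 2 ≤ r) (hw : ‖w‖ = 1) (hwt : ‖wt‖ = 1)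
    (hη : 0 ≤ η) (hηr : η * r ≤ 1 / 8) (i : Fin n) : ‖innerStep x η wt w i‖ = 1 :=
  NormedSpace.norm_normalize_eq_one_iff.mpr (step_ne_zero hr hx hw hwt hη hηr i)

theorem norm_innerStep_sub_le (hr : 0 ≤ r) (hx : ∀ i, ‖x i‖ ^ 2 ≤ r) (hw : ‖w‖ = 1)
    (hwt : ‖wt‖ = 1) (hη : 0 ≤ η) (hηr : η * r ≤ 1 / 8) (i : Fin n) :
    ‖innerStep x η wt w i - w‖ ≤ 6 * (η * r) := by
  refine (norm_normalize_add_sub_le hw (step_ne_zero hr hx hw hwt hη hηr i)).trans ?_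
  rw [norm_smul, Real.norm_of_nonneg hη]
  nlinarith [norm_step_direction_le hr hx hw hwt i]

end OneStep

/-! ### Potential function along one epoch -/

section Epoch

variable {n d : ℕ} {x : Fin n → EuclideanSpace ℝ (Fin d)} {η r s t : ℝ}
  {v wt w : EuclideanSpace ℝ (Fin d)}

/-- The step-size and spectral conditions under which one inner step contracts in expectation. -/
structure StepRegime (x : Fin n → EuclideanSpace ℝ (Fin d)) (η r s t : ℝ)
    (v : EuclideanSpace ℝ (Fin d)) : Prop where
  n_ne_zero : n ≠ 0
  r_nonneg : 0 ≤ r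
  norm_sq_le : ∀ i, ‖x i‖ ^ 2 ≤ r
  norm_eq_one : ‖v‖ = 1
  fullBatch_eq : fullBatch x v = s • v
  t_nonneg : 0 ≤ t
  t_le_s : t ≤ s
  norm_fullBatch_le : ∀ y, inner ℝ y v = 0 → ‖fullBatch x y‖ ≤ t * ‖y‖
  eta_nonneg : 0 ≤ η
  eta_mul_r_le : η * r ≤ 1 / 8
  eta_mul_r_sq_le : 12800 * (η * r ^ 2) ≤ s - t

/-- The expectation of `f` at the end of `k` further inner steps from `w`, with anchor `wt`. -/
def stepAverage (x : Fin n → EuclideanSpace ℝ (Fin d)) (η : ℝ) (wt : EuclideanSpace ℝ (Fin d))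
    (f : EuclideanSpace ℝ (Fin d) → ℝ) : ℕ → EuclideanSpace ℝ (Fin d) → ℝ
  | 0, w => f w
  | k + 1, w => (n : ℝ)⁻¹ * ∑ i, stepAverage x η wt f k (innerStep x η wt w i)

theorem average_le_of_forall_le {c : ℝ} (hn : n ≠ 0) {f : Fin n → ℝ} (h : ∀ i, f i ≤ c) :
    (n : ℝ)⁻¹ * ∑ i, f i ≤ c := by
  have hn' : (0 : ℝ) < n := by exact_mod_cast Nat.pos_of_ne_zero hn
  rw [inv_mul_le_iff₀ hn']
  simpa using Finset.sum_le_sum fun i (_ : i ∈ Finset.univ) => h i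

theorem stepAverage_le_one (hn : n ≠ 0) {f : EuclideanSpace ℝ (Fin d) → ℝ} (hf : ∀ y, f y ≤ 1)
    (k : ℕ) (w : EuclideanSpace ℝ (Fin d)) : stepAverage x η wt f k w ≤ 1 := by
  induction k generalizing w with
  | zero => exact hf w
  | succ k ih => exact average_le_of_forall_le hn fun i => ih _

/-- The exponential moment of the squared sine grows by a factor `1 + O(θ η² r²)` per step. -/
theorem average_exp_sinSq_innerStep_le (h : StepRegime x η r s t v) (hw : ‖w‖ = 1)
    (hwt : ‖wt‖ = 1) (hwv : 1 / 2 ≤ (inner ℝ w v : ℝ)) (hwtv : 0 ≤ (inner ℝ wt v : ℝ))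
    (hb : sinSq v wt ≤ 1 / 2) {θ : ℝ} (hθ : 0 ≤ θ) (hθη : 12 * (θ * (η * r)) ≤ 1) :
    (n : ℝ)⁻¹ * ∑ i, Real.exp (θ * (sinSq v (innerStep x η wt w i) - 3 / 4)) ≤
      Real.exp (θ * (sinSq v w - 3 / 4)) *
        (1 + (400 * θ + 144 * θ ^ 2) * (η ^ 2 * r ^ 2)) := by
  have hn' : (0 : ℝ) < n := by exact_mod_cast Nat.pos_of_ne_zero h.n_ne_zero
  have hηr0 : 0 ≤ η * r := mul_nonneg h.eta_nonneg h.r_nonneg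
  have hi : ∀ i, Real.exp (θ * (sinSq v (innerStep x η wt w i) - 3 / 4)) ≤
      Real.exp (θ * (sinSq v w - 3 / 4)) *
        (1 + θ * (sinSq v (innerStep x η wt w i) - sinSq v w) +
          144 * θ ^ 2 * (η ^ 2 * r ^ 2)) := fun i => by
    have h1 : |θ * (sinSq v (innerStep x η wt w i) - sinSq v w)| ≤ 12 * (θ * (η * r)) := by
      have h2 := abs_sinSq_sub_sinSq_le h.norm_eq_one hw
        (norm_innerStep h.r_nonneg h.norm_sq_le hw hwt h.eta_nonneg h.eta_mul_r_le i)
      have h3 := norm_innerStep_sub_le h.r_nonneg h.norm_sq_le hw hwt h.eta_nonneg h.eta_mul_r_le i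
      rw [abs_mul, abs_of_nonneg hθ]
      nlinarith
    -- exp z ≤ 1 + z + z² for |z| ≤ 1; the condition 12θηr ≤ 1 is there for this step.
    have h4 := (abs_le.mp (Real.abs_exp_sub_one_sub_id_le (h1.trans hθη))).2
    have h5 : (θ * (sinSq v (innerStep x η wt w i) - sinSq v w)) ^ 2 ≤
        144 * θ ^ 2 * (η ^ 2 * r ^ 2) := by
      rw [← sq_abs]
      calc _ ≤ (12 * (θ * (η * r))) ^ 2 := by gcongr
        _ = _ := by ring
    rw [show θ * (sinSq v (innerStep x η wt w i) - 3 / 4) = θ * (sinSq v w - 3 / 4) +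
      θ * (sinSq v (innerStep x η wt w i) - sinSq v w) by ring, Real.exp_add]
    gcongr
    linarith
  have havg := average_sinSq_innerStep_le h.n_ne_zero h.r_nonneg h.norm_sq_le h.norm_eq_one hw hwt
    h.fullBatch_eq h.t_nonneg h.t_le_s h.norm_fullBatch_le h.eta_nonneg h.eta_mul_r_le
    h.eta_mul_r_sq_le hwv hwtv
  have hdrift : (n : ℝ)⁻¹ * ∑ i, (sinSq v (innerStep x η wt w i) - sinSq v w) ≤
      400 * (η ^ 2 * r ^ 2) := by
    rw [Finset.sum_sub_distrib, mul_sub, Finset.sum_const, Finset.card_univ, Fintype.card_fin,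
      nsmul_eq_mul, inv_mul_cancel_left₀ hn'.ne']
    have h1 : 0 ≤ η * (s - t) * sinSq v w :=
      mul_nonneg (mul_nonneg h.eta_nonneg (by linarith [h.t_le_s])) (sinSq_nonneg h.norm_eq_one hw)
    have h2 : 800 * (η ^ 2 * r ^ 2) * sinSq v wt ≤ 800 * (η ^ 2 * r ^ 2) * (1 / 2) := by gcongr
    linarith
  calc _ ≤ (n : ℝ)⁻¹ * ∑ i, Real.exp (θ * (sinSq v w - 3 / 4)) *
        (1 + θ * (sinSq v (innerStep x η wt w i) - sinSq v w) +
          144 * θ ^ 2 * (η ^ 2 * r ^ 2)) := by gcongr with i; exact hi i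
    _ = Real.exp (θ * (sinSq v w - 3 / 4)) *
        (1 + θ * ((n : ℝ)⁻¹ * ∑ i, (sinSq v (innerStep x η wt w i) - sinSq v w)) +
          144 * θ ^ 2 * (η ^ 2 * r ^ 2)) := by
        rw [← Finset.mul_sum, Finset.sum_add_distrib, Finset.sum_add_distrib, ← Finset.mul_sum]
        simp only [Finset.sum_const, Finset.card_univ, Fintype.card_fin, nsmul_eq_mul]
        field_simp
    _ ≤ _ := by
        apply mul_le_mul_of_nonneg_left _ (Real.exp_pos _).le
        linarith [mul_le_mul_of_nonneg_left hdrift hθ]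

/-- Indicator of the failure to come `γ`-close to the direction `v`. -/
def missIndicator (v : EuclideanSpace ℝ (Fin d)) (γ : ℝ) (w : EuclideanSpace ℝ (Fin d)) : ℝ :=
  open Classical in if sinSq v w ≤ γ ∧ 1 / √2 ≤ (inner ℝ w v : ℝ) then 0 else 1

theorem missIndicator_le_one (γ : ℝ) (w : EuclideanSpace ℝ (Fin d)) :
    missIndicator v γ w ≤ 1 := by
  unfold missIndicator; split_ifs <;> norm_num

theorem missIndicator_nonneg (γ : ℝ) (w : EuclideanSpace ℝ (Fin d)) :
    0 ≤ missIndicator v γ w := by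
  unfold missIndicator; split_ifs <;> norm_num

/-- A small squared sine leaves the sign open; being above -1/2 excludes the neighbourhood of -v. -/
theorem inv_sqrt_two_le_of_sinSq_le {γ : ℝ} (hγ : γ ≤ 1 / 2) (hw : sinSq v w ≤ γ)
    (hwv : -(1 / 2) < (inner ℝ w v : ℝ)) : 1 / √2 ≤ (inner ℝ w v : ℝ) := by
  unfold sinSq at hw
  have h0 : (0 : ℝ) ≤ inner ℝ w v := by nlinarith
  rw [← Real.sqrt_one, ← Real.sqrt_div zero_le_one]
  exact Real.sqrt_le_iff.mpr ⟨h0, by linarith⟩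

/-- Supermartingale bound for the probability that an epoch ends away from the direction `v`. -/
theorem stepAverage_missIndicator_le (h : StepRegime x η r s t v) (hwt : ‖wt‖ = 1)
    (hwtv : 0 ≤ (inner ℝ wt v : ℝ)) {β γ θ c : ℝ} (hb : sinSq v wt ≤ β) (hβ : β ≤ 1 / 2)
    (hγ0 : 0 < γ) (hγ : γ ≤ 1 / 2) (hθ : 0 ≤ θ) (hθη : 12 * (θ * (η * r)) ≤ 1)
    (hκ : η * (s - t) ≤ 16) (hc : 800 * (η ^ 2 * r ^ 2) * β ≤ η * (s - t) / 16 * c) (hc0 : 0 ≤ c)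
    (k : ℕ) (hw : ‖w‖ = 1) (hwv : -(1 / 2) < (inner ℝ w v : ℝ)) :
    stepAverage x η wt (missIndicator v γ) k w ≤
      Real.exp (θ * (sinSq v w - 3 / 4)) *
        (1 + (400 * θ + 144 * θ ^ 2) * (η ^ 2 * r ^ 2)) ^ k +
      ((1 - η * (s - t) / 16) ^ k * (sinSq v w - c) + c) / γ := by
  set ν := (400 * θ + 144 * θ ^ 2) * (η ^ 2 * r ^ 2) with hν
  have hν0 : 0 ≤ ν := by positivity
  set κ := η * (s - t) / 16 with hκdef
  have hκ0 : 0 ≤ κ := by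
    have := mul_nonneg h.eta_nonneg (sub_nonneg.mpr h.t_le_s)
    rw [hκdef]; linarith
  have hκ1 : 0 ≤ 1 - κ := by rw [hκdef]; linarith
  have hpow : ∀ k : ℕ, (1 - κ) ^ k ≤ 1 := fun k => pow_le_one₀ hκ1 (by linarith)
  -- Nonnegativity of the Markov term is needed after an exit from the cone, where the exponential
  -- term alone carries the bound.
  have hsecond : ∀ (k : ℕ) {w : EuclideanSpace ℝ (Fin d)}, ‖w‖ = 1 →
      0 ≤ ((1 - κ) ^ k * (sinSq v w - c) + c) / γ := fun k w hw => by
    apply div_nonneg _ hγ0.le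
    nlinarith [hpow k, pow_nonneg hκ1 k, mul_nonneg (pow_nonneg hκ1 k)
      (sinSq_nonneg h.norm_eq_one hw), mul_le_mul_of_nonneg_right (hpow k) hc0]
  induction k generalizing w with
  | zero =>
    simp only [stepAverage, pow_zero, mul_one, one_mul, sub_add_cancel]
    rw [missIndicator]
    split_ifs with hm
    · exact add_nonneg (Real.exp_pos _).le (div_nonneg (sinSq_nonneg h.norm_eq_one hw) hγ0.le)
    · have h1 : γ < sinSq v w := by
        by_contra h2
        exact hm ⟨not_lt.mp h2, inv_sqrt_two_le_of_sinSq_le hγ (not_lt.mp h2) hwv⟩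
      have h3 : 1 ≤ sinSq v w / γ := by rw [one_le_div hγ0]; exact h1.le
      linarith [Real.exp_pos (θ * (sinSq v w - 3 / 4))]
  | succ k ih =>
    rcases lt_or_ge (inner ℝ w v : ℝ) (1 / 2) with hlt | hge
    · refine (stepAverage_le_one h.n_ne_zero (missIndicator_le_one γ) _ _).trans ?_
      -- Here -1/2 < ⟨w, v⟩ < 1/2, so the squared sine exceeds 3/4 and the exponential is already at
      -- least 1.
      have h1 : 0 ≤ sinSq v w - 3 / 4 := by unfold sinSq; nlinarith
      have h2 : 1 ≤ Real.exp (θ * (sinSq v w - 3 / 4)) := Real.one_le_exp (mul_nonneg hθ h1)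
      have h3 : 1 ≤ (1 + ν) ^ (k + 1) := one_le_pow₀ (by linarith)
      nlinarith [hsecond (k + 1) hw]
    · rw [stepAverage]
      have hn' : (0 : ℝ) < n := by exact_mod_cast Nat.pos_of_ne_zero h.n_ne_zero
      -- A step moves by at most 6ηr ≤ 3/4, so from ⟨w, v⟩ ≥ 1/2 it cannot jump over the band (-1/2,
      -- 1/2).
      have hstep : ∀ i, -(1 / 2) < (inner ℝ (innerStep x η wt w i) v : ℝ) := fun i => by
        have h3 := norm_innerStep_sub_le h.r_nonneg h.norm_sq_le hw hwt h.eta_nonneg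
          h.eta_mul_r_le i
        have h4 : |(inner ℝ (innerStep x η wt w i - w) v : ℝ)| ≤ ‖innerStep x η wt w i - w‖ := by
          simpa [h.norm_eq_one] using abs_real_inner_le_norm (innerStep x η wt w i - w) v
        rw [inner_sub_left] at h4
        linarith [(abs_le.mp h4).1, h.eta_mul_r_le]
      have hexp := average_exp_sinSq_innerStep_le h hw hwt hge hwtv (hb.trans hβ) hθ hθη
      have havg := average_sinSq_innerStep_le h.n_ne_zero h.r_nonneg h.norm_sq_le h.norm_eq_one hw
        hwt h.fullBatch_eq h.t_nonneg h.t_le_s h.norm_fullBatch_le h.eta_nonneg h.eta_mul_r_le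
        h.eta_mul_r_sq_le hge hwtv
      rw [← hκdef] at havg
      rw [← hν] at hexp
      calc _ ≤ (n : ℝ)⁻¹ * ∑ i, (Real.exp (θ * (sinSq v (innerStep x η wt w i) - 3 / 4)) *
            (1 + ν) ^ k + ((1 - κ) ^ k * (sinSq v (innerStep x η wt w i) - c) + c) / γ) := by
            gcongr with i
            exact ih (norm_innerStep h.r_nonneg h.norm_sq_le hw hwt h.eta_nonneg h.eta_mul_r_le i)
              (hstep i)
        _ = ((n : ℝ)⁻¹ * ∑ i, Real.exp (θ * (sinSq v (innerStep x η wt w i) - 3 / 4))) *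
            (1 + ν) ^ k + ((1 - κ) ^ k * ((n : ℝ)⁻¹ * ∑ i, sinSq v (innerStep x η wt w i) - c)
              + c) / γ := by
            rw [Finset.sum_add_distrib, ← Finset.sum_mul, ← Finset.sum_div,
              Finset.sum_add_distrib, ← Finset.mul_sum, Finset.sum_sub_distrib]
            simp only [Finset.sum_const, Finset.card_univ, Fintype.card_fin, nsmul_eq_mul]
            generalize ∑ i, Real.exp (θ * (sinSq v (innerStep x η wt w i) - 3 / 4)) = S
            field_simp
        _ ≤ Real.exp (θ * (sinSq v w - 3 / 4)) * (1 + ν) * (1 + ν) ^ k +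
            ((1 - κ) ^ k * ((1 - κ) * (sinSq v w - c)) + c) / γ := by
            have h5 : 800 * (η ^ 2 * r ^ 2) * sinSq v wt ≤ κ * c :=
              (mul_le_mul_of_nonneg_left hb (by positivity)).trans hc
            have h6 : (n : ℝ)⁻¹ * ∑ i, sinSq v (innerStep x η wt w i) - c ≤
                (1 - κ) * (sinSq v w - c) := by linarith
            have h7 := pow_nonneg hκ1 k
            gcongr
        _ = _ := by rw [pow_succ, pow_succ]; ring

end Epoch

/-! ### Choice of parameters for one epoch -/

section EpochBound

variable {n d : ℕ} {x : Fin n → EuclideanSpace ℝ (Fin d)} {η r s t : ℝ}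
  {v wt : EuclideanSpace ℝ (Fin d)}

/-- With θ = 16Λ, b ≤ 1/2 gives the exponent -4Λ at the start, and M steps add barely more than Λ.
At most -2Λ remains, and exp(-2Λ) = δ²/4. -/
theorem exp_term_le {Λ δ b V : ℝ} {M : ℕ} (hΛ0 : 0 ≤ Λ) (hexp : Real.exp (-Λ) = δ / 2)
    (hδ0 : 0 ≤ δ) (hδ1 : δ ≤ 1) (hb : b ≤ 1 / 2) (hV : 0 ≤ V) (hM1 : M * V ≤ 1 / 6400)
    (hM2 : M * V * Λ ≤ (1 / 6400) ^ 2) :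
    Real.exp (16 * Λ * (b - 3 / 4)) * (1 + (400 * (16 * Λ) + 144 * (16 * Λ) ^ 2) * V) ^ M ≤
      δ / 4 := by
  calc _ ≤ Real.exp (16 * Λ * (b - 3 / 4)) *
        Real.exp ((400 * (16 * Λ) + 144 * (16 * Λ) ^ 2) * V) ^ M := by
        gcongr
        rw [add_comm]; exact Real.add_one_le_exp _
    _ = Real.exp (16 * Λ * (b - 3 / 4) +
        M * ((400 * (16 * Λ) + 144 * (16 * Λ) ^ 2) * V)) := by
        rw [Real.exp_add, ← Real.exp_nat_mul]
    _ ≤ Real.exp (-Λ + -Λ) := by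
        apply Real.exp_le_exp.mpr
        have h2 := mul_le_mul_of_nonneg_left hM1 hΛ0
        have h3 := mul_le_mul_of_nonneg_left hM2 hΛ0
        have h4 := mul_le_mul_of_nonneg_left hb hΛ0
        linarith
    _ ≤ δ / 4 := by rw [Real.exp_add, hexp]; nlinarith

/-- Mκ ≥ 4Λ shrinks the initial error by (δ/2)⁴ ≤ δ²/16, and the noise floor c obeys the same δ²/16;
their sum is δ/4 times the target (δ/2)β. -/
theorem contraction_term_le {Λ δ b β c κ : ℝ} {M : ℕ} (hexp : Real.exp (-Λ) = δ / 2)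
    (hδ0 : 0 < δ) (hδ1 : δ ≤ 1) (hb : b ≤ β) (hβ0 : 0 < β) (hκ : κ ≤ 1)
    (hκM : 4 * Λ ≤ M * κ) (hc0 : 0 ≤ c) (hc : c ≤ δ ^ 2 / 16 * β) :
    ((1 - κ) ^ M * (b - c) + c) / (δ / 2 * β) ≤ δ / 4 := by
  rw [div_le_iff₀ (by positivity)]
  have h3 : (1 - κ) ^ M ≤ (δ / 2) ^ 4 := by
    calc _ ≤ Real.exp (-κ) ^ M := by
          exact pow_le_pow_left₀ (by linarith) (Real.one_sub_le_exp_neg _) _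
      _ = Real.exp (M * -κ) := (Real.exp_nat_mul _ _).symm
      _ ≤ Real.exp ((4 : ℕ) * -Λ) := by
          apply Real.exp_le_exp.mpr; push_cast; linarith
      _ = _ := by rw [Real.exp_nat_mul, hexp]
  have h4 : 0 ≤ (1 - κ) ^ M := pow_nonneg (by linarith) _
  have h5 : (1 - κ) ^ M * (b - c) ≤ (δ / 2) ^ 4 * β := by
    calc _ ≤ (1 - κ) ^ M * β := by gcongr; linarith
      _ ≤ _ := by gcongr
  have h6 : (δ / 2) ^ 4 ≤ δ ^ 2 / 16 := by
    have : δ ^ 2 ≤ 1 := by nlinarith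
    nlinarith [sq_nonneg δ]
  have h7 : (δ / 2) ^ 4 * β ≤ δ ^ 2 / 16 * β := by gcongr
  linarith

/-- With the parameters of the algorithm, an epoch started in the cone around `v` fails with
probability at most `δ / 2` to shrink the squared sine by the factor `δ / 2`. -/
theorem stepAverage_missIndicator_le_half (h : StepRegime x η r s t v) {δ β : ℝ} {M : ℕ}
    (hwt : ‖wt‖ = 1) (hwtv : 1 / √2 ≤ (inner ℝ wt v : ℝ)) (hb : sinSq v wt ≤ β) (hβ0 : 0 < β)
    (hβ : β ≤ 1 / 2) (hδ0 : 0 < δ) (hδ1 : δ < 1) (hη : 0 < η) (hst : 0 < s - t)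
    (hηg : η * (s - t) ≤ 1) (hη1 : η * r ^ 2 ≤ 1 / 250000 * δ ^ 2 * (s - t))
    (hM : 64 * Real.log (2 / δ) / (η * (s - t)) ≤ M)
    (hM' : M * η ^ 2 * r ^ 2 + r * √(M * η ^ 2 * Real.log (2 / δ)) ≤ 1 / 6400) :
    stepAverage x η wt (missIndicator v (δ / 2 * β)) M wt ≤ δ / 2 := by
  set Λ := Real.log (2 / δ) with hΛ
  have hΛ0 : 0 < Λ := Real.log_pos (by rw [lt_div_iff₀ hδ0]; linarith)
  have hexp : Real.exp (-Λ) = δ / 2 := by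
    rw [Real.exp_neg, hΛ, Real.exp_log (by positivity), inv_div]
  have hM64 : 64 * Λ ≤ M * (η * (s - t)) := by
    rwa [div_le_iff₀ (mul_pos hη hst)] at hM
  have hr := h.r_nonneg
  have hM1 : (M : ℝ) * (η ^ 2 * r ^ 2) ≤ 1 / 6400 := by
    have : 0 ≤ r * √(M * η ^ 2 * Λ) := by positivity
    linarith
  have hM2 : (M : ℝ) * (η ^ 2 * r ^ 2) * Λ ≤ (1 / 6400) ^ 2 := by
    have h1 : r * √(M * η ^ 2 * Λ) ≤ 1 / 6400 := by
      have : 0 ≤ (M : ℝ) * η ^ 2 * r ^ 2 := by positivity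
      linarith
    have h2 := pow_le_pow_left₀ (by positivity) h1 2
    rw [mul_pow, Real.sq_sqrt (by positivity)] at h2
    linarith
  have hθη : 12 * (16 * Λ * (η * r)) ≤ 1 := by
    -- As M ≥ 64Λ, the bound on Mη²r²Λ also bounds (8Ληr)².
    have h1 : 64 * Λ ≤ M := hM64.trans (mul_le_of_le_one_right (by positivity) hηg)
    have h2 : (8 * (Λ * (η * r))) ^ 2 ≤ (1 / 6400) ^ 2 := by
      calc (8 * (Λ * (η * r))) ^ 2 = 64 * Λ * ((η ^ 2 * r ^ 2) * Λ) := by ring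
        _ ≤ M * ((η ^ 2 * r ^ 2) * Λ) := by gcongr
        _ ≤ _ := by linarith
    have h3 := le_of_sq_le_sq h2 (by norm_num)
    linarith
  have hwtv0 : (0 : ℝ) < inner ℝ wt v := lt_of_lt_of_le (by positivity) hwtv
  -- The noise floor of the recursion: 12800 = 16 · 800 comes from dividing 800η²r²β by the rate
  -- ηλ/16, and 250000 makes 12800/250000 ≤ 1/16.
  set c := 12800 / 250000 * δ ^ 2 * β with hcdef
  have hc : 800 * (η ^ 2 * r ^ 2) * β ≤ η * (s - t) / 16 * c := by
    have := mul_le_mul_of_nonneg_left hη1 (by positivity : 0 ≤ 800 * η * β)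
    rw [hcdef]; linarith
  have key := stepAverage_missIndicator_le h hwt hwtv0.le hb hβ (by positivity : 0 < δ / 2 * β)
    (by nlinarith) (by positivity : 0 ≤ 16 * Λ) hθη (by linarith) hc (by positivity) M hwt
    (by linarith)
  have h1 := exp_term_le hΛ0.le hexp hδ0.le hδ1.le (hb.trans hβ)
    (by positivity : 0 ≤ η ^ 2 * r ^ 2) hM1 hM2
  have h2 := contraction_term_le (c := c) (κ := η * (s - t) / 16) (M := M) hexp hδ0 hδ1.le hb hβ0
    (by linarith) (by linarith) (by positivity) (by rw [hcdef]; gcongr; linarith [sq_nonneg δ])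
  linarith

end EpochBound

/-! ### Averaging over one independent pick -/

section FreshPick

/-- Averaging over a uniform variable that is independent of the past. -/
theorem integral_eq_integral_average {Ω α : Type*} [MeasurableSpace Ω] {P : Measure Ω}
    [IsProbabilityMeasure P] [MeasurableSpace α] [MeasurableSingletonClass α] [Finite α] {n : ℕ}
    {Y : Ω → α} {I : Ω → Fin n} (hY : Measurable Y) (hI : Measurable I) (hYI : IndepFun Y I P)
    (hunif : ∀ i, P {ω | I ω = i} = (n : ENNReal)⁻¹) (φ : α → Fin n → ℝ) :
    ∫ ω, φ (Y ω) (I ω) ∂P = ∫ ω, (n : ℝ)⁻¹ * ∑ i, φ (Y ω) i ∂P := by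
  have hφ : ∀ i, Measurable fun a => φ a i := fun i => measurable_of_finite _
  -- The past takes finitely many values, so every function of it is measurable and bounded.
  have hint : ∀ f : α → ℝ, Integrable (fun ω => f (Y ω)) P := fun f => by
    obtain ⟨C, hC⟩ := (Set.finite_range fun a => ‖f a‖).bddAbove
    exact Integrable.of_bound ((measurable_of_finite f).comp hY).aestronglyMeasurable C
      (ae_of_all _ fun ω => hC ⟨Y ω, rfl⟩)
  set χ : Fin n → Fin n → ℝ := fun i j => if j = i then 1 else 0
  have hχ : ∀ i, ∫ ω, χ i (I ω) ∂P = (n : ℝ)⁻¹ := fun i => by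
    have : (fun ω => χ i (I ω)) = Set.indicator {ω | I ω = i} 1 := by
      ext ω; simp [χ, Set.indicator_apply]
    have hm : MeasurableSet {ω | I ω = i} := hI (measurableSet_singleton i)
    rw [this, integral_indicator_one hm, measureReal_def, hunif]
    simp
  have hsplit : ∀ ω, φ (Y ω) (I ω) = ∑ i, φ (Y ω) i * χ i (I ω) := fun ω => by simp [χ]
  have hprod : ∀ i, ∫ ω, φ (Y ω) i * χ i (I ω) ∂P = (n : ℝ)⁻¹ * ∫ ω, φ (Y ω) i ∂P := fun i => by
    have hind : IndepFun (fun ω => φ (Y ω) i) (fun ω => χ i (I ω)) P :=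
      hYI.comp (hφ i) (measurable_of_finite (χ i))
    rw [hind.integral_fun_mul_eq_mul_integral (hint fun a => φ a i).aestronglyMeasurable
      ((measurable_of_finite (χ i)).comp hI).aestronglyMeasurable, hχ, mul_comm]
  simp_rw [hsplit]
  rw [integral_finsetSum, integral_const_mul, integral_finsetSum, Finset.mul_sum]
  · exact Finset.sum_congr rfl fun i _ => hprod i
  · exact fun i _ => hint fun a => φ a i
  · intro i _
    refine (hint fun a => φ a i).mul_bdd (c := 1)
      ((measurable_of_finite (χ i)).comp hI).aestronglyMeasurable (ae_of_all _ fun ω => ?_)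
    simp only [χ]; split_ifs <;> simp

end FreshPick

/-! ### Dependence on the picks, unit norms and measurability -/

section Paths

variable {n d : ℕ} {x : Fin n → EuclideanSpace ℝ (Fin d)} {η r s t : ℝ} {M : ℕ}
  {v wt g₀ : EuclideanSpace ℝ (Fin d)}

theorem epochIterate_congr {pk pk' : ℕ → Fin n} (k : ℕ) (h : ∀ j < k, pk j = pk' j) :
    epochIterate x η wt pk k = epochIterate x η wt pk' k := by
  induction k with
  | zero => rfl
  | succ k ih => rw [epochIterate, epochIterate, ih fun j hj => h j (by omega), h k (by omega)]

theorem estimate_congr {pk pk' : ℕ × ℕ → Fin n} (l : ℕ)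
    (h : ∀ p : ℕ × ℕ, p.1 < l → p.2 < M → pk p = pk' p) :
    estimate x η M g₀ pk l = estimate x η M g₀ pk' l := by
  induction l with
  | zero => rfl
  | succ l ih =>
    rw [estimate, estimate, ih fun p hp => h p (by omega)]
    exact epochIterate_congr M fun j hj => h (l, j) (Nat.lt_succ_self l) hj

theorem norm_epochIterate (h : StepRegime x η r s t v) (hwt : ‖wt‖ = 1) (pk : ℕ → Fin n) (k : ℕ) :
    ‖epochIterate x η wt pk k‖ = 1 := by
  induction k with
  | zero => exact hwt
  | succ k ih =>
    exact norm_innerStep h.r_nonneg h.norm_sq_le ih hwt h.eta_nonneg h.eta_mul_r_le _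

theorem norm_estimate (h : StepRegime x η r s t v) (hg : ‖NormedSpace.normalize g₀‖ = 1)
    (pk : ℕ × ℕ → Fin n) (l : ℕ) : ‖estimate x η M g₀ pk l‖ = 1 := by
  induction l with
  | zero => exact hg
  | succ l ih => exact norm_epochIterate h ih _ M

theorem measurable_normalize : Measurable
    (NormedSpace.normalize : EuclideanSpace ℝ (Fin d) → EuclideanSpace ℝ (Fin d)) := by
  unfold NormedSpace.normalize; fun_prop

theorem measurable_innerStep {T : Type*} [MeasurableSpace T]
    {a b : T → EuclideanSpace ℝ (Fin d)} {i : T → Fin n} (ha : Measurable a) (hb : Measurable b)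
    (hi : Measurable i) : Measurable fun τ => innerStep x η (a τ) (b τ) (i τ) := by
  have hx : Measurable fun τ => x (i τ) := (measurable_of_finite x).comp hi
  have hfull : Measurable fun τ => fullBatch x (a τ) := by
    have hsum : Measurable fun τ => ∑ i, (inner ℝ (x i) (a τ) : ℝ) • x i :=
      Finset.measurable_fun_sum _ fun i _ => (measurable_const.inner ha).smul_const (x i)
    exact hsum.const_smul (n : ℝ)⁻¹
  have hc : Measurable fun τ => (inner ℝ (x (i τ)) (b τ) - inner ℝ (x (i τ)) (a τ) : ℝ) :=
    (hx.inner hb).sub (hx.inner ha)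
  have hdir : Measurable fun τ =>
      (inner ℝ (x (i τ)) (b τ) - inner ℝ (x (i τ)) (a τ) : ℝ) • x (i τ) + fullBatch x (a τ) :=
    (hc.smul hx).add hfull
  exact measurable_normalize.comp (hb.add (hdir.const_smul η))

theorem measurable_epochIterate {T : Type*} [MeasurableSpace T]
    {a : T → EuclideanSpace ℝ (Fin d)} {pk : T → ℕ → Fin n} (ha : Measurable a)
    (hpk : ∀ j, Measurable fun τ => pk τ j) (k : ℕ) :
    Measurable fun τ => epochIterate x η (a τ) (pk τ) k := by
  induction k with
  | zero => exact ha
  | succ k ih => exact measurable_innerStep ha ih (hpk k)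

theorem measurable_estimate {T : Type*} [MeasurableSpace T]
    {a : T → EuclideanSpace ℝ (Fin d)} {pk : T → ℕ × ℕ → Fin n} (ha : Measurable a)
    (hpk : ∀ p, Measurable fun τ => pk τ p) (l : ℕ) :
    Measurable fun τ => estimate x η M (a τ) (pk τ) l := by
  induction l with
  | zero => exact measurable_normalize.comp ha
  | succ l ih => exact measurable_epochIterate ih (fun j => hpk (l, j)) M

theorem stepAverage_nonneg {f : EuclideanSpace ℝ (Fin d) → ℝ} (hf : ∀ y, 0 ≤ f y) (k : ℕ)
    (w : EuclideanSpace ℝ (Fin d)) : 0 ≤ stepAverage x η wt f k w := by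
  induction k generalizing w with
  | zero => exact hf w
  | succ k ih => exact mul_nonneg (by positivity) (Finset.sum_nonneg fun i _ => ih _)

end Paths

/-! ### From conditional averages to failure probabilities -/

section Probability

variable {n d : ℕ} {x : Fin n → EuclideanSpace ℝ (Fin d)} {η r s t : ℝ} {M : ℕ}
  {v : EuclideanSpace ℝ (Fin d)}
  {Ω : Type*} [MeasurableSpace Ω] {P : Measure Ω} [IsProbabilityMeasure P]
  {pick : ℕ × ℕ → Ω → Fin n}

/-- Conditioning on the past of step `k + 1` of epoch `l + 1` replaces the step by its average. -/
theorem integral_stepAverage_succ (hn : n ≠ 0) (hpick : ∀ p, Measurable (pick p))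
    (hunif : ∀ p i, P {ω | pick p ω = i} = (n : ENNReal)⁻¹) (hind : iIndepFun pick P)
    (g₀ : EuclideanSpace ℝ (Fin d)) (K f : EuclideanSpace ℝ (Fin d) → ℝ) (l j k : ℕ) :
    ∫ ω, K (estimate x η M g₀ (pick · ω) l) * stepAverage x η (estimate x η M g₀ (pick · ω) l) f
        (k + 1) (epochIterate x η (estimate x η M g₀ (pick · ω) l) (fun m => pick (l, m) ω) j) ∂P =
    ∫ ω, K (estimate x η M g₀ (pick · ω) l) * stepAverage x η (estimate x η M g₀ (pick · ω) l) f
        k (epochIterate x η (estimate x η M g₀ (pick · ω) l) (fun m => pick (l, m) ω) (j + 1))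
          ∂P := by
  classical
  -- The picks already revealed. With a deterministic start they determine the current iterate;
  -- `ext` fills all later picks with an irrelevant default.
  set S : Finset (ℕ × ℕ) := (Finset.range l ×ˢ Finset.range M) ∪ ({l} ×ˢ Finset.range j) with hS
  set Y : Ω → (S → Fin n) := fun ω p => pick p ω with hYdef
  have hY : Measurable Y := measurable_pi_lambda _ fun p => hpick p
  have hnot : (l, j) ∉ S := by simp [hS]
  have hYI : IndepFun Y (pick (l, j)) P :=
    (hind.indepFun_finset S {(l, j)} (by simpa using hnot) hpick).comp measurable_id
      (measurable_pi_apply (⟨(l, j), by simp⟩ : ({(l, j)} : Finset (ℕ × ℕ))))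
  set ext : (S → Fin n) → ℕ × ℕ → Fin n := fun a p =>
    if hp : p ∈ S then a ⟨p, hp⟩ else ⟨0, Nat.pos_of_ne_zero hn⟩ with hext
  have hext_eq : ∀ ω, ∀ p ∈ S, ext (Y ω) p = pick p ω := fun ω p hp => by simp [hext, hYdef, hp]
  have hest : ∀ ω, estimate x η M g₀ (ext (Y ω)) l = estimate x η M g₀ (pick · ω) l := fun ω =>
    estimate_congr l fun p h1 h2 => hext_eq ω p (by simp [hS, h1, h2])
  have hepo : ∀ ω, epochIterate x η (estimate x η M g₀ (pick · ω) l)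
      (fun m => ext (Y ω) (l, m)) j =
      epochIterate x η (estimate x η M g₀ (pick · ω) l) (fun m => pick (l, m) ω) j := fun ω =>
    epochIterate_congr j fun m hm => hext_eq ω (l, m) (by simp [hS, hm])
  have key := integral_eq_integral_average hY (hpick (l, j)) hYI (hunif (l, j)) fun a i =>
    K (estimate x η M g₀ (ext a) l) * stepAverage x η (estimate x η M g₀ (ext a) l) f k
      (innerStep x η (estimate x η M g₀ (ext a) l)
        (epochIterate x η (estimate x η M g₀ (ext a) l) (fun m => ext a (l, m)) j) i)
  simp only [hest, hepo] at key
  refine Eq.trans ?_ key.symm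
  congr 1
  ext ω
  rw [stepAverage, ← Finset.mul_sum]
  ring

/-- Conditioning step by step identifies the recursive average with a conditional expectation given
the epoch's start; the weight K later restricts to starts in the cone. -/
theorem integral_stepAverage (hn : n ≠ 0) (hpick : ∀ p, Measurable (pick p))
    (hunif : ∀ p i, P {ω | pick p ω = i} = (n : ENNReal)⁻¹) (hind : iIndepFun pick P)
    (g₀ : EuclideanSpace ℝ (Fin d)) (K f : EuclideanSpace ℝ (Fin d) → ℝ) (l : ℕ) :
    ∫ ω, K (estimate x η M g₀ (pick · ω) l) * stepAverage x η (estimate x η M g₀ (pick · ω) l) f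
        M (estimate x η M g₀ (pick · ω) l) ∂P =
    ∫ ω, K (estimate x η M g₀ (pick · ω) l) * f (estimate x η M g₀ (pick · ω) (l + 1)) ∂P := by
  have h : ∀ j k, j + k = M →
      ∫ ω, K (estimate x η M g₀ (pick · ω) l) * stepAverage x η (estimate x η M g₀ (pick · ω) l) f
        k (epochIterate x η (estimate x η M g₀ (pick · ω) l) (fun m => pick (l, m) ω) j) ∂P =
      ∫ ω, K (estimate x η M g₀ (pick · ω) l) * f (estimate x η M g₀ (pick · ω) (l + 1)) ∂P := by
    intro j k
    induction k generalizing j with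
    | zero => rintro rfl; rfl
    | succ k ih =>
      intro hjk
      rw [integral_stepAverage_succ hn hpick hunif hind]
      exact ih (j + 1) (by omega)
  exact h 0 M (zero_add M)

/-- The vectors in the cone of half-angle 45° around `v` whose squared sine is at most `β`. -/
def narrowCone (v : EuclideanSpace ℝ (Fin d)) (β : ℝ) : Set (EuclideanSpace ℝ (Fin d)) :=
  {w | sinSq v w ≤ β ∧ 1 / √2 ≤ (inner ℝ w v : ℝ)}

theorem measurableSet_narrowCone (v : EuclideanSpace ℝ (Fin d)) (β : ℝ) :
    MeasurableSet (narrowCone v β) := by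
  have h : Measurable fun w : EuclideanSpace ℝ (Fin d) => (inner ℝ w v : ℝ) :=
    measurable_id.inner measurable_const
  unfold narrowCone sinSq
  exact (measurableSet_le (measurable_const.sub (h.pow_const 2)) measurable_const).inter
    (measurableSet_le measurable_const h)

theorem missIndicator_eq_indicator (v : EuclideanSpace ℝ (Fin d)) (γ : ℝ) :
    missIndicator v γ = (narrowCone v γ)ᶜ.indicator 1 := by
  ext w
  classical
  rw [Set.indicator_apply, missIndicator]
  by_cases h : sinSq v w ≤ γ ∧ 1 / √2 ≤ (inner ℝ w v : ℝ)
  · rw [if_pos h, if_neg fun hc => hc h]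
  · rw [if_neg h, if_pos (show w ∈ (narrowCone v γ)ᶜ from h)]; rfl

/-- For a deterministic start in the cone, the failure probability grows by at most `δ / 2` per
epoch. -/
theorem measureReal_estimate_notMem_narrowCone_le (h : StepRegime x η r s t v)
    (hpick : ∀ p, Measurable (pick p))
    (hunif : ∀ p i, P {ω | pick p ω = i} = (n : ENNReal)⁻¹) (hind : iIndepFun pick P)
    {g₀ : EuclideanSpace ℝ (Fin d)} (hg : 1 / √2 ≤ (inner ℝ (NormedSpace.normalize g₀) v : ℝ))
    {δ : ℝ} (hδ0 : 0 < δ) (hδ1 : δ < 1) (hη : 0 < η) (hst : 0 < s - t)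
    (hηg : η * (s - t) ≤ 1) (hη1 : η * r ^ 2 ≤ 1 / 250000 * δ ^ 2 * (s - t))
    (hM : 64 * Real.log (2 / δ) / (η * (s - t)) ≤ M)
    (hM' : M * η ^ 2 * r ^ 2 + r * √(M * η ^ 2 * Real.log (2 / δ)) ≤ 1 / 6400) (l : ℕ) :
    P.real {ω | estimate x η M g₀ (pick · ω) l ∉ narrowCone v ((δ / 2) ^ l * (1 / 2))} ≤
      l * (δ / 2) := by
  have hg1 : ‖NormedSpace.normalize g₀‖ = 1 := by
    rw [NormedSpace.norm_normalize_eq_one_iff]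
    rintro rfl
    rw [NormedSpace.normalize_zero_eq_zero, inner_zero_left] at hg
    exact absurd hg (not_le.mpr (by positivity))
  induction l with
  | zero =>
    have hmem : NormedSpace.normalize g₀ ∈ narrowCone v ((δ / 2) ^ 0 * (1 / 2)) := by
      refine ⟨?_, hg⟩
      have := pow_le_pow_left₀ (by positivity) hg 2
      rw [div_pow, one_pow, Real.sq_sqrt zero_le_two] at this
      unfold sinSq; linarith
    have hempty : {ω | estimate x η M g₀ (pick · ω) 0 ∉ narrowCone v ((δ / 2) ^ 0 * (1 / 2))} = ∅ :=
      Set.eq_empty_of_forall_notMem fun ω hω => hω hmem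
    rw [hempty]; simp
  | succ l ih =>
    set β := (δ / 2) ^ l * (1 / 2) with hβ
    have hβ0 : 0 < β := by positivity
    have hβ1 : β ≤ 1 / 2 := by
      have : (δ / 2) ^ l ≤ 1 := pow_le_one₀ (by positivity) (by linarith)
      linarith
    have hγ : (δ / 2) ^ (l + 1) * (1 / 2) = δ / 2 * β := by rw [hβ]; ring
    rw [hγ]
    set e : ℕ → Ω → EuclideanSpace ℝ (Fin d) := fun l ω => estimate x η M g₀ (pick · ω) l with he
    have hmeas : ∀ l, Measurable (e l) := fun l => measurable_estimate measurable_const hpick l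
    -- Only a first failure in this epoch is new; its indicator is the cone weight times the miss
    -- indicator, so the one-epoch bound applies under the integral.
    have hnew : P.real {ω | e l ω ∈ narrowCone v β ∧ e (l + 1) ω ∉ narrowCone v (δ / 2 * β)} ≤
        δ / 2 := by
      have hms : MeasurableSet
          {ω | e l ω ∈ narrowCone v β ∧ e (l + 1) ω ∉ narrowCone v (δ / 2 * β)} :=
        (hmeas l (measurableSet_narrowCone v β)).inter
          (hmeas (l + 1) (measurableSet_narrowCone v (δ / 2 * β)).compl)
      rw [← integral_indicator_one hms]
      have h1 : ∀ ω, Set.indicator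
          {ω | e l ω ∈ narrowCone v β ∧ e (l + 1) ω ∉ narrowCone v (δ / 2 * β)} (1 : Ω → ℝ) ω =
          (narrowCone v β).indicator 1 (e l ω) * missIndicator v (δ / 2 * β) (e (l + 1) ω) := by
        intro ω
        classical
        rw [missIndicator_eq_indicator]
        simp only [Set.indicator_apply, Set.mem_ofPred_eq, Set.mem_compl_iff, Pi.one_apply]
        split_ifs <;> simp_all
      simp_rw [h1]
      rw [← integral_stepAverage h.n_ne_zero hpick hunif hind g₀
        ((narrowCone v β).indicator 1) (missIndicator v (δ / 2 * β)) l]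
      have h2 := integral_mono_of_nonneg (μ := P) (f := fun ω =>
        (narrowCone v β).indicator 1 (e l ω) * stepAverage x η (e l ω)
          (missIndicator v (δ / 2 * β)) M (e l ω)) (g := fun _ => δ / 2)
        (ae_of_all _ fun ω => mul_nonneg (Set.indicator_nonneg (fun _ _ => zero_le_one) _)
          (stepAverage_nonneg (missIndicator_nonneg _) _ _)) (integrable_const _)
        (ae_of_all _ fun ω => by
          by_cases hmem : e l ω ∈ narrowCone v β
          · simp only [Set.indicator_of_mem hmem, Pi.one_apply, one_mul]
            exact stepAverage_missIndicator_le_half h (norm_estimate h hg1 _ l) hmem.2 hmem.1 hβ0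
              hβ1 hδ0 hδ1 hη hst hηg hη1 hM hM'
          · simp only [Set.indicator_of_notMem hmem, zero_mul]
            positivity)
      simpa using h2
    have hsub : {ω | e (l + 1) ω ∉ narrowCone v (δ / 2 * β)} ⊆
        {ω | e l ω ∉ narrowCone v β} ∪
          {ω | e l ω ∈ narrowCone v β ∧ e (l + 1) ω ∉ narrowCone v (δ / 2 * β)} := by
      intro ω hω
      by_cases hmem : e l ω ∈ narrowCone v β
      · exact Or.inr ⟨hmem, hω⟩
      · exact Or.inl hmem
    have h3 := (measureReal_mono hsub (measure_ne_top P _)).trans (measureReal_union_le _ _)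
    push_cast
    linarith

/-- Fubini for a random start that is independent of the picks. -/
theorem measure_inter_le_of_indepFun {α β : Type*} [MeasurableSpace α] [MeasurableSpace β]
    {g : Ω → α} {Y : Ω → β} (hg : Measurable g) (hY : Measurable Y) (hgY : IndepFun g Y P)
    {G : Set α} (hG : MeasurableSet G) {B : Set (α × β)} (hB : MeasurableSet B) {c : ENNReal}
    (h : ∀ a ∈ G, P {ω | (a, Y ω) ∈ B} ≤ c) :
    P {ω | g ω ∈ G ∧ (g ω, Y ω) ∈ B} ≤ c * P {ω | g ω ∈ G} := by
  have hlaw := (indepFun_iff_map_prod_eq_prod_map_map hg.aemeasurable hY.aemeasurable).mp hgY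
  have hmG : MeasurableSet ((Prod.fst ⁻¹' G) ∩ B : Set (α × β)) := (measurable_fst hG).inter hB
  have : IsProbabilityMeasure (P.map Y) := Measure.isProbabilityMeasure_map hY.aemeasurable
  have h1 : P {ω | g ω ∈ G ∧ (g ω, Y ω) ∈ B} =
      (P.map fun ω => (g ω, Y ω)) ((Prod.fst ⁻¹' G) ∩ B) := by
    rw [Measure.map_apply (hg.prodMk hY) hmG]; rfl
  have h2 : P {ω | g ω ∈ G} = P.map g G := by rw [Measure.map_apply hg hG]; rfl
  rw [h1, hlaw, Measure.prod_apply hmG, h2, ← lintegral_indicator_const hG]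
  refine lintegral_mono fun a => ?_
  rw [Measure.map_apply hY (measurable_prodMk_left hmG)]
  by_cases ha : a ∈ G
  · rw [Set.indicator_of_mem ha]
    exact (measure_mono fun ω hω => hω.2).trans (h a ha)
  · rw [Set.indicator_of_notMem ha, nonpos_iff_eq_zero]
    convert measure_empty (μ := P)
    ext ω
    simp [ha]

end Probability

/-! ### Prediction error as a quadratic form -/

section Prediction

variable {d : ℕ} {μ : Measure (EuclideanSpace ℝ (Fin d))}

theorem integrable_coord_mul_coord
    (hμ : MemLp (fun y : EuclideanSpace ℝ (Fin d) => y) 2 μ) (j k : Fin d) :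
    Integrable (fun y : EuclideanSpace ℝ (Fin d) => y j * y k) μ := by
  have h : ∀ j, MemLp (fun y : EuclideanSpace ℝ (Fin d) => y j) 2 μ := fun j =>
    (EuclideanSpace.proj (𝕜 := ℝ) j).comp_memLp' hμ
  exact (h j).integrable_mul (h k)

theorem norm_inner_sq_eq_sum (y z : EuclideanSpace ℝ (Fin d)) :
    ‖(inner ℝ y z : ℝ)‖ ^ 2 = ∑ j, ∑ k, z j * (y j * y k * z k) := by
  rw [Real.norm_eq_abs, sq_abs, sq, PiLp.inner_apply, Finset.sum_mul_sum]
  refine Finset.sum_congr rfl fun j _ => Finset.sum_congr rfl fun k _ => ?_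
  simp only [RCLike.inner_apply, conj_trivial]
  ring

theorem integrable_norm_inner_sq (hμ : MemLp (fun y : EuclideanSpace ℝ (Fin d) => y) 2 μ)
    (z : EuclideanSpace ℝ (Fin d)) : Integrable (fun y => ‖(inner ℝ y z : ℝ)‖ ^ 2) μ := by
  simp_rw [norm_inner_sq_eq_sum]
  exact integrable_finsetSum _ fun j _ => integrable_finsetSum _ fun k _ =>
    ((integrable_coord_mul_coord hμ j k).mul_const _).const_mul _

theorem integral_norm_inner_sq (hμ : MemLp (fun y : EuclideanSpace ℝ (Fin d) => y) 2 μ)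
    (z : EuclideanSpace ℝ (Fin d)) :
    ∫ y, ‖(inner ℝ y z : ℝ)‖ ^ 2 ∂μ = z.ofLp ⬝ᵥ (trueCov μ *ᵥ z.ofLp) := by
  have hint : ∀ j k, Integrable (fun y : EuclideanSpace ℝ (Fin d) =>
      z j * (y j * y k * z k)) μ := fun j k =>
    ((integrable_coord_mul_coord hμ j k).mul_const _).const_mul _
  simp_rw [norm_inner_sq_eq_sum]
  rw [integral_finsetSum _ fun j _ => integrable_finsetSum _ fun k _ => hint j k]
  simp only [dotProduct, Matrix.mulVec, trueCov, Matrix.of_apply, Finset.mul_sum]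
  refine Finset.sum_congr rfl fun j _ => ?_
  rw [integral_finsetSum _ fun k _ => hint j k]
  refine Finset.sum_congr rfl fun k _ => ?_
  rw [integral_const_mul, integral_mul_const]

theorem lambdaMax_trueCov_nonneg (hd : 2 ≤ d)
    (hμ : MemLp (fun y : EuclideanSpace ℝ (Fin d) => y) 2 μ) :
    0 ≤ lambdaMax hd (trueCov_isHermitian μ) := by
  have h := dotProduct_mulVec_le_lambdaMax hd (trueCov_isHermitian μ)
    (EuclideanSpace.single ⟨0, by omega⟩ 1)
  rw [← integral_norm_inner_sq hμ, PiLp.norm_single, norm_one, one_pow, mul_one] at h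
  exact (integral_nonneg fun y => sq_nonneg _).trans h

end Prediction

/-! ### Assembling the parameters -/

section Main

variable {n d : ℕ} {x : Fin n → EuclideanSpace ℝ (Fin d)} {η r δ : ℝ}
  {v w : EuclideanSpace ℝ (Fin d)}

theorem stepRegime_of_eigengap (hd : 2 ≤ d) (hn : n ≠ 0) (hr : 0 < r) (hx : ∀ i, ‖x i‖ ^ 2 ≤ r)
    (hgap : 0 < eigengap hd (sampleCov_isHermitian x)) (hv : ‖v‖ = 1)
    (hAv : sampleCov x *ᵥ v.ofLp = lambdaMax hd (sampleCov_isHermitian x) • v.ofLp)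
    (hδ0 : 0 < δ) (hδ1 : δ < 1) (hη : 0 < η)
    (hη1 : η ≤ 1 / 250000 * δ ^ 2 / r ^ 2 * eigengap hd (sampleCov_isHermitian x)) :
    StepRegime x η r (lambdaMax hd (sampleCov_isHermitian x))
      (lambdaMax hd (sampleCov_isHermitian x) - eigengap hd (sampleCov_isHermitian x)) v ∧
    η * eigengap hd (sampleCov_isHermitian x) ≤ 1 ∧
    η * r ^ 2 ≤ 1 / 250000 * δ ^ 2 * eigengap hd (sampleCov_isHermitian x) := by
  have hv0 : v ≠ 0 := norm_pos_iff.mp (by rw [hv]; exact one_pos)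
  have hfull : fullBatch x v = lambdaMax hd (sampleCov_isHermitian x) • v := by
    rw [← toLp_sampleCov_mulVec, hAv, ← WithLp.ofLp_smul, WithLp.toLp_ofLp]
  obtain ⟨ht, hperp⟩ := norm_mulVec_le_of_inner_eq_zero hd (sampleCov_isHermitian x)
    (fun z => by rw [toLp_sampleCov_mulVec]; exact inner_fullBatch_self_nonneg x z) hgap hv0 hAv
  simp_rw [toLp_sampleCov_mulVec] at hperp
  set s := lambdaMax hd (sampleCov_isHermitian x)
  set lam := eigengap hd (sampleCov_isHermitian x)
  -- Together with λ ≤ s, which is nonnegativity of the second eigenvalue, this turns the bound on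
  -- ηr² into ηr ≤ 1/250000.
  have hsr : s ≤ r := by
    have := norm_fullBatch_le hr.le hx v
    rw [hfull, norm_smul, hv, mul_one, mul_one] at this
    exact (le_abs_self s).trans this
  have hηr2 : η * r ^ 2 ≤ 1 / 250000 * δ ^ 2 * lam := by
    rwa [div_mul_eq_mul_div, le_div_iff₀ (by positivity)] at hη1
  have hδ2 : δ ^ 2 ≤ 1 := by nlinarith
  have hηr2' : η * r ^ 2 ≤ 1 / 250000 * lam := by nlinarith
  have hηr : η * r ≤ 1 / 250000 := by
    have : η * r * r ≤ 1 / 250000 * r := by linarith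
    exact le_of_mul_le_mul_right this hr
  refine ⟨⟨hn, hr.le, hx, hv, hfull, ht, by linarith, hperp, hη.le, by linarith, ?_⟩, ?_, hηr2⟩
  · linarith
  · have : η * lam ≤ η * r := by gcongr; linarith
    linarith

theorem norm_sub_sq_le_of_sinSq_le {ε : ℝ} (hv : ‖v‖ = 1) (hw : ‖w‖ = 1)
    (hwv : 0 ≤ (inner ℝ w v : ℝ)) (h : sinSq v w ≤ ε) : ‖w - v‖ ^ 2 ≤ 2 - 2 * √(1 - ε) := by
  have : √(1 - ε) ≤ inner ℝ w v :=
    Real.sqrt_le_iff.mpr ⟨hwv, by unfold sinSq at h; linarith⟩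
  rw [norm_sub_sq_real, hv, hw]
  linarith

theorem pow_ceil_log_div_log_le {ε : ℝ} (hδ0 : 0 < δ) (hδ1 : δ < 1) (hε0 : 0 < ε) :
    (δ / 2) ^ ⌈Real.log (1 / ε) / Real.log (2 / δ)⌉₊ ≤ ε := by
  set Λ := Real.log (2 / δ) with hΛ
  have hΛ0 : 0 < Λ := Real.log_pos (by rw [lt_div_iff₀ hδ0]; linarith)
  have hexp : Real.exp (-Λ) = δ / 2 := by
    rw [Real.exp_neg, hΛ, Real.exp_log (by positivity), inv_div]
  have hL := Nat.le_ceil (Real.log (1 / ε) / Λ)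
  rw [div_le_iff₀ hΛ0, one_div, Real.log_inv] at hL
  rw [← hexp, ← Real.exp_nat_mul, one_div, Real.log_inv]
  calc _ ≤ Real.exp (Real.log ε) := Real.exp_le_exp.mpr (by linarith)
    _ = ε := Real.exp_log hε0

/-- Since log(2/δ) ≥ log 2, the ceiling is at most log₂(1/ε) + 1 ≤ 2 max(1, log₂(1/ε)); the 2
cancels against the δ/2 lost per epoch. -/
theorem ceil_log_div_log_mul_le {ε : ℝ} (hδ0 : 0 < δ) (hδ1 : δ < 1) (hε0 : 0 < ε) (hε1 : ε < 1) :
    ⌈Real.log (1 / ε) / Real.log (2 / δ)⌉₊ * (δ / 2) ≤ max 1 (Real.logb 2 (1 / ε)) * δ := by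
  have hlog : 0 < Real.log (1 / ε) := Real.log_pos (by rw [lt_div_iff₀ hε0]; linarith)
  have h2 : Real.log 2 ≤ Real.log (2 / δ) :=
    Real.log_le_log two_pos (by rw [le_div_iff₀ hδ0]; linarith)
  have hlog2 : 0 < Real.log 2 := Real.log_pos one_lt_two
  have h3 : Real.log (1 / ε) / Real.log (2 / δ) ≤ Real.logb 2 (1 / ε) :=
    div_le_div_of_nonneg_left hlog.le hlog2 h2
  have h4 := (Nat.ceil_lt_add_one (div_nonneg hlog.le (hlog2.le.trans h2))).le
  have h5 := le_max_left 1 (Real.logb 2 (1 / ε))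
  have h6 := le_max_right 1 (Real.logb 2 (1 / ε))
  nlinarith

end Main

end QuasiPS

end

theorem mainTheorem1 :
    ∃ c₁ c₂ c₃ : ℝ, 0 < c₁ ∧ 0 < c₂ ∧ 0 < c₃ ∧
      ∀ (d n : ℕ) (hd : 2 ≤ d) (x : Fin n → EuclideanSpace ℝ (Fin d))
        (r δ ε η : ℝ) (M : ℕ) (wstar : EuclideanSpace ℝ (Fin d))
        -- the law of a fresh observation, with finite second moment
        (μ : Measure (EuclideanSpace ℝ (Fin d))) [IsProbabilityMeasure μ]
        (_ : MemLp (fun y : EuclideanSpace ℝ (Fin d) => y) 2 μ)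
        -- the randomness of the algorithm: initial vector and uniform picks, all independent
        (Ω : Type*) [MeasurableSpace Ω] (P : Measure Ω) [IsProbabilityMeasure P]
        (g : Ω → EuclideanSpace ℝ (Fin d)) (pick : ℕ × ℕ → Ω → Fin n),
        0 < r → (∀ i, ‖x i‖ ^ 2 ≤ r) →
        0 < QuasiPS.eigengap hd (QuasiPS.sampleCov_isHermitian x) →
        ‖wstar‖ = 1 →
        (QuasiPS.sampleCov x) *ᵥ wstar.ofLp =
          QuasiPS.lambdaMax hd (QuasiPS.sampleCov_isHermitian x) • wstar.ofLp →
        0 < δ → δ < 1 → 0 < ε → ε < 1 → 0 < η →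
        η ≤ c₁ * δ ^ 2 / r ^ 2 * QuasiPS.eigengap hd (QuasiPS.sampleCov_isHermitian x) →
        c₂ * Real.log (2 / δ) / (η * QuasiPS.eigengap hd (QuasiPS.sampleCov_isHermitian x)) ≤ M →
        M * η ^ 2 * r ^ 2 + r * √(M * η ^ 2 * Real.log (2 / δ)) ≤ c₃ →
        Measurable g → (∀ p, Measurable (pick p)) →
        (∀ p i, P {ω | pick p ω = i} = (n : ENNReal)⁻¹) →
        iIndepFun pick P →
        IndepFun g (fun ω p => pick p ω) P →
        let wt : ℕ → Ω → EuclideanSpace ℝ (Fin d) :=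
          fun l ω => QuasiPS.estimate x η M (g ω) (fun p => pick p ω) l
        let L : ℕ := ⌈Real.log (1 / ε) / Real.log (2 / δ)⌉₊
        let lmax : ℝ := QuasiPS.lambdaMax hd (QuasiPS.trueCov_isHermitian μ)
        let good : Set Ω := {ω | 1 / √2 ≤ inner ℝ (wt 0 ω) wstar}
        P good ≠ 0 →
        (∀ ω,
          Integrable (fun y => ‖inner ℝ y (wt L ω) - inner ℝ y wstar‖ ^ 2) μ ∧
          ∫ y, ‖inner ℝ y (wt L ω) - inner ℝ y wstar‖ ^ 2 ∂μ =
            (wt L ω - wstar).ofLp ⬝ᵥ (QuasiPS.trueCov μ *ᵥ (wt L ω - wstar).ofLp) ∧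
          (wt L ω - wstar).ofLp ⬝ᵥ (QuasiPS.trueCov μ *ᵥ (wt L ω - wstar).ofLp) ≤
            lmax * ‖wt L ω - wstar‖ ^ 2) ∧
        1 - max 1 (Real.logb 2 (1 / ε)) * δ ≤
          (P[|good]).real {ω |
            ‖wt L ω - wstar‖ ^ 2 ≤ 2 - 2 * √(1 - ε) ∧
            ∫ y, ‖inner ℝ y (wt L ω) - inner ℝ y wstar‖ ^ 2 ∂μ ≤
              (2 - 2 * √(1 - ε)) * lmax} := by
  refine ⟨1 / 250000, 64, 1 / 6400, by norm_num, by norm_num, by norm_num, ?_⟩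
  intro d n hd x r δ ε η M wstar μ _ hμ Ω _ P _ g pick hr hx hgap hv hAv hδ0 hδ1 hε0 hε1 hη hη1
    hM hM' hg hpick hunif hind hgind wt L lmax good hgood
  have hpred : ∀ ω,
      Integrable (fun y => ‖inner ℝ y (wt L ω) - inner ℝ y wstar‖ ^ 2) μ ∧
      ∫ y, ‖inner ℝ y (wt L ω) - inner ℝ y wstar‖ ^ 2 ∂μ =
        (wt L ω - wstar).ofLp ⬝ᵥ (QuasiPS.trueCov μ *ᵥ (wt L ω - wstar).ofLp) ∧
      (wt L ω - wstar).ofLp ⬝ᵥ (QuasiPS.trueCov μ *ᵥ (wt L ω - wstar).ofLp) ≤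
        lmax * ‖wt L ω - wstar‖ ^ 2 := fun ω => by
    simp_rw [← inner_sub_right]
    exact ⟨QuasiPS.integrable_norm_inner_sq hμ _, QuasiPS.integral_norm_inner_sq hμ _,
      QuasiPS.dotProduct_mulVec_le_lambdaMax hd _ _⟩
  refine ⟨hpred, ?_⟩
  have hn : n ≠ 0 := by
    -- The good event has positive measure, hence contains an outcome, whose pick would lie in `Fin
    -- 0`.
    rintro rfl
    obtain ⟨ω, -⟩ := nonempty_of_measure_ne_zero hgood
    exact (pick (0, 0) ω).elim0
  obtain ⟨hreg, hηg, hηr⟩ :=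
    QuasiPS.stepRegime_of_eigengap hd hn hr hx hgap hv hAv hδ0 hδ1 hη hη1
  rw [← sub_sub_cancel (QuasiPS.lambdaMax hd (QuasiPS.sampleCov_isHermitian x))
    (QuasiPS.eigengap hd (QuasiPS.sampleCov_isHermitian x))] at hgap hηg hηr hM
  set β : ℝ := (δ / 2) ^ L * (1 / 2) with hβ
  have hβε : β ≤ ε := by
    have := QuasiPS.pow_ceil_log_div_log_le hδ0 hδ1 hε0
    have h0 : 0 ≤ (δ / 2) ^ L := by positivity
    linarith
  set G : Set (EuclideanSpace ℝ (Fin d)) :=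
    {g₀ | 1 / √2 ≤ (inner ℝ (NormedSpace.normalize g₀) wstar : ℝ)} with hG
  have hGm : MeasurableSet G :=
    measurableSet_le measurable_const (QuasiPS.measurable_normalize.inner measurable_const)
  set B : Set (EuclideanSpace ℝ (Fin d) × (ℕ × ℕ → Fin n)) :=
    {q | QuasiPS.estimate x η M q.1 q.2 L ∉ QuasiPS.narrowCone wstar β} with hB
  have hBm : MeasurableSet B :=
    QuasiPS.measurable_estimate measurable_fst (fun p => (measurable_pi_apply p).comp measurable_snd)
      L (QuasiPS.measurableSet_narrowCone wstar β).compl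
  have hfail := QuasiPS.measure_inter_le_of_indepFun hg (measurable_pi_lambda _ hpick) hgind hGm hBm
    (c := ENNReal.ofReal (L * (δ / 2))) fun g₀ hg₀ => by
      rw [ENNReal.le_ofReal_iff_toReal_le (measure_ne_top _ _) (by positivity)]
      exact QuasiPS.measureReal_estimate_notMem_narrowCone_le hreg hpick hunif hind hg₀ hδ0 hδ1 hη
        hgap hηg hηr hM hM' L
  have hgoodm : MeasurableSet good := hg hGm
  have := cond_isProbabilityMeasure hgood
  set S : Set Ω := {ω |
    ‖wt L ω - wstar‖ ^ 2 ≤ 2 - 2 * √(1 - ε) ∧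
    ∫ y, ‖inner ℝ y (wt L ω) - inner ℝ y wstar‖ ^ 2 ∂μ ≤ (2 - 2 * √(1 - ε)) * lmax} with hS
  have hsub : good ∩ Sᶜ ⊆ {ω | g ω ∈ G ∧ (g ω, fun p => pick p ω) ∈ B} := by
    rintro ω ⟨hω, hωS⟩
    refine ⟨hω, fun hcone => hωS ?_⟩
    have hnorm : ‖NormedSpace.normalize (g ω)‖ = 1 := by
      rw [NormedSpace.norm_normalize_eq_one_iff]
      intro h0
      have h1 : 1 / √2 ≤ (inner ℝ (NormedSpace.normalize (g ω)) wstar : ℝ) := hω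
      rw [h0, NormedSpace.normalize_zero_eq_zero, inner_zero_left] at h1
      exact absurd h1 (not_le.mpr (by positivity))
    have hdist : ‖wt L ω - wstar‖ ^ 2 ≤ 2 - 2 * √(1 - ε) :=
      QuasiPS.norm_sub_sq_le_of_sinSq_le hv (QuasiPS.norm_estimate hreg hnorm _ L)
        ((by positivity : (0 : ℝ) ≤ 1 / √2).trans hcone.2) (hcone.1.trans hβε)
    refine ⟨hdist, ?_⟩
    rw [(hpred ω).2.1, mul_comm]
    exact (hpred ω).2.2.trans
      (mul_le_mul_of_nonneg_left hdist (QuasiPS.lambdaMax_trueCov_nonneg hd hμ))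
  have hcompl : (P[|good]).real Sᶜ ≤ L * (δ / 2) := by
    apply ENNReal.toReal_le_of_le_ofReal (by positivity)
    rw [cond_apply hgoodm]
    calc (P good)⁻¹ * P (good ∩ Sᶜ)
        ≤ (P good)⁻¹ * (ENNReal.ofReal (L * (δ / 2)) * P good) := by
          gcongr; exact (measure_mono hsub).trans hfail
      _ = ENNReal.ofReal (L * (δ / 2)) := by
          rw [mul_comm, mul_assoc, ENNReal.mul_inv_cancel hgood (measure_ne_top _ _), mul_one]
  -- Subadditivity suffices here and avoids proving that S is measurable.
  have hone : 1 ≤ (P[|good]).real S + (P[|good]).real Sᶜ := by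
    have := measureReal_union_le (μ := P[|good]) S Sᶜ
    rwa [Set.union_compl_self, probReal_univ] at this
  have hL := QuasiPS.ceil_log_div_log_mul_le hδ0 hδ1 hε0 hε1
  linarith
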